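/- Let $n\ge 1$ and let $\mathcal B$ be the space of linear operators on $(\mathbb C^2)^{\otimes n}$, with $X_i,Y_i,Z_i$ the Pauli operators acting on qubit $i$. Let $\mathcal G=\{Z_i\}_{i=1}^{n}\cup\{X_iX_{i+1}\}_{i=1}^{n-1}$, let $\mathfrak g\simeq\mathfrak{so}(2n)$ be the real Lie algebra generated by $i\mathcal G$ under commutators, and let $G=e^{\mathfrak g}$ with normalized Haar measure $dU$. Let $U(\vec\theta)=\prod_{l=1}^{L}e^{-i\theta_lH_l}$ with $H_l\in\mathcal G$ be a parametrized matchgate circuit, with $\vec\theta\in\mathbb R^L$ drawn from some probability law, that forms a $2$-design over $G$, i.e. $\mathbb E_{\vec\theta}[U(\vec\theta)^{\otimes t}A\,(U(\vec\theta)^\dagger)^{\otimes t}]=\int_G dU\,U^{\otimes t}A\,(U^\dagger)^{\otimes t}$ for all $t\le 2$ and all operators $A$ on $((\mathbb C^2)^{\otimes n})^{\otimes t}$. Let $c_{2j-1}=Z_1\cdots Z_{j-1}X_j$ and $c_{2j}=Z_1\cdots Z_{j-1}Y_j$ ($1\le j\le n$) be the Majorana operators, let $\mathcal B_\kappa$ ($0\le\kappa\le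 2n$) be the complex span of the products of $\kappa$ distinct Majorana operators, let $M_\kappa$ be the orthogonal projection of $M\in\mathcal B$ onto $\mathcal B_\kappa$ with respect to the Hilbert--Schmidt inner product, and let $P=Z^{\otimes n}$. For $M_1,M_2,\Gamma\in\mathcal B$ put $\langle M_1,M_2\rangle_\Gamma=\mathrm{Tr}[\Gamma M_1^\dagger M_2]$, and define the $\kappa$-purity $\mathcal P_\kappa(M)=\langle M_\kappa,M_\kappa\rangle_{\mathbb 1}$ and the $\kappa$-coherence $\mathcal C_\kappa(M)=i^{\kappa \bmod 2}\,\langle M_\kappa,M_{2n-\kappa}\rangle_P$. Then for every state $\rho$ (positive semidefinite, of trace one) and every Hermitian observable $O$, the loss $\ell_{\vec\theta}(\rho,O)=\mathrm{Tr}[U(\vec\theta)\rho\,U(\vec\theta)^\dagger O]$ is real and square-integrable, its mean is $$\mathbb E_{\vec\theta}[\ell_{\vec\theta}(\rho,O)]=\sum_{\kappa=0,2n}\langle\rho_\kappa,O_\kappa\rangle_{\mathbb 1+P},$$ and its variance is $$\mathrm{Var}_{\vec\theta}[\ell_{\vec\theta}(\rho,O)]=\sum_{\kappa=1}^{2n-1}\frac{\mathcal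 P_\kappa(\rho)\mathcal P_\kappa(O)+\mathcal C_\kappa(\rho)\mathcal C_\kappa(O)}{\dim(\mathcal B_\kappa)},\qquad \dim(\mathcal B_\kappa)=\binom{2n}{\kappa}.$$ -/

import Mathlib

open MeasureTheory ProbabilityTheory Matrix
open scoped ComplexOrder

noncomputable section

namespace Matchgate

/-- The computational basis of `n` qubits: bit strings of length `n`. -/
abbrev Bits (n : ℕ) : Type := Fin n → Fin 2

/-- The space of linear operators on `(ℂ²)^{⊗ n}`. -/
abbrev Op (n : ℕ) : Type := Matrix (Bits n) (Bits n) ℂ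

/-- The tensor (Kronecker) product `A 0 ⊗ A 1 ⊗ ⋯ ⊗ A (m-1)` of a finite family of operators. -/
def tensorProd {m : ℕ} {ι : Type} (A : Fin m → Matrix ι ι ℂ) :
    Matrix (Fin m → ι) (Fin m → ι) ℂ :=
  Matrix.of fun a b => ∏ k, A k (a k) (b k)

/-- The tensor power `M^{⊗ t}`. -/
def tensorPow (t : ℕ) {ι : Type} (M : Matrix ι ι ℂ) : Matrix (Fin t → ι) (Fin t → ι) ℂ :=
  tensorProd fun _ : Fin t => M

/-- The Pauli matrix `X`. -/
def pauliX : Matrix (Fin 2) (Fin 2) ℂ := !![0, 1; 1, 0]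

/-- The Pauli matrix `Y`. -/
def pauliY : Matrix (Fin 2) (Fin 2) ℂ := !![0, -Complex.I; Complex.I, 0]

/-- The Pauli matrix `Z`. -/
def pauliZ : Matrix (Fin 2) (Fin 2) ℂ := !![1, 0; 0, -1]

/-! ### Circuit generators, Lie algebra and Lie group -/

/-- Labels of the circuit generators: `Z_i` for every qubit `i`, and `X_i X_{i+1}` for every pair of
neighbouring qubits. -/
inductive Generator (n : ℕ) : Type
  | z (i : Fin n) : Generator n
  | xx (i : Fin n) (h : (i : ℕ) + 1 < n) : Generator n

/-- The Hermitian operator with the given label. -/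
def Generator.toOp {n : ℕ} : Generator n → Op n
  | .z i => tensorProd fun k => if k = i then pauliZ else 1
  | .xx i _ => tensorProd fun k => if k = i ∨ (k : ℕ) = (i : ℕ) + 1 then pauliX else 1

attribute [local instance 100] LieRing.ofAssociativeRing

/-- The dynamical Lie algebra: the real Lie algebra (with the commutator as bracket) generated by
the operators `i H`, where `H` runs over the circuit generators. -/
def dla (n : ℕ) : LieSubalgebra ℝ (Op n) :=
  LieSubalgebra.lieSpan ℝ (Op n) {A | ∃ H : Generator n, A = Complex.I • H.toOp}

/-- The Lie group `G = e^𝔤` inside the unitary group, generated by the exponentials of the elements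
of the dynamical Lie algebra. -/
def group (n : ℕ) : Subgroup (Matrix.unitaryGroup (Bits n) ℂ) :=
  Subgroup.closure {U | ∃ A ∈ dla n, (U : Op n) = NormedSpace.exp A}

instance (n : ℕ) : MeasurableSpace (group n) := borel (group n)

instance (n : ℕ) : BorelSpace (group n) := ⟨rfl⟩

/-- The operator on `n` qubits underlying an element of the group. -/
def groupOp {n : ℕ} (g : group n) : Op n := ((g : Matrix.unitaryGroup (Bits n) ℂ) : Op n)

/-- The parametrized circuit `U(θ) = ∏ₗ e^{-i θₗ Hₗ}` (ordered product). -/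
def circuit {n L : ℕ} (H : Fin L → Generator n) (θ : Fin L → ℝ) : Op n :=
  (List.ofFn fun l => NormedSpace.exp ((-(Complex.I * (θ l : ℂ))) • (H l).toOp)).prod

/-- A random operator `U` (depending on a random parameter with law `μ`) forms a `T`-design over the
group, with respect to the (normalized Haar) measure `ν` on it: for all `t ≤ T` and all operators
`A`, the averages of `U^{⊗ t} A (U^†)^{⊗ t}` over `μ` and of `g^{⊗ t} A (g^†)^{⊗ t}` over `ν` agree,
entry by entry. -/
def IsDesign {n : ℕ} {Θ : Type} [MeasurableSpace Θ] (T : ℕ) (μ : Measure Θ) (U : Θ → Op n)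
    (ν : Measure (group n)) : Prop :=
  ∀ t ≤ T, ∀ (A : Matrix (Fin t → Bits n) (Fin t → Bits n) ℂ) (a b : Fin t → Bits n),
    ∫ θ, (tensorPow t (U θ) * A * tensorPow t (U θ)ᴴ) a b ∂μ =
      ∫ g, (tensorPow t (groupOp g) * A * tensorPow t (groupOp g)ᴴ) a b ∂ν

/-! ### Majorana operators and modules -/

/-- The Majorana operators. With indices counted from `0`, the operators `2j` and `2j+1` are
`Z ⋯ Z X 1 ⋯ 1` and `Z ⋯ Z Y 1 ⋯ 1`, the letter `X` or `Y` standing at qubit `j`. -/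
def majorana {n : ℕ} (m : Fin (2 * n)) : Op n :=
  tensorProd fun k =>
    if (k : ℕ) < (m : ℕ) / 2 then pauliZ
    else if (k : ℕ) = (m : ℕ) / 2 then (if (m : ℕ) % 2 = 0 then pauliX else pauliY)
    else 1

/-- The product of the distinct Majorana operators indexed by `s`, in increasing order. -/
def majoranaProd {n : ℕ} (s : Finset (Fin (2 * n))) : Op n :=
  ((s.sort (· ≤ ·)).map majorana).prod

/-- The fermionic parity operator `P = Z^{⊗ n}`. -/
def parity (n : ℕ) : Op n := tensorProd fun _ : Fin n => pauliZ

/-- The module `𝓑_κ`: the complex span of the products of `κ` distinct Majorana operators. -/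
def majoranaModule (n κ : ℕ) : Submodule ℂ (Op n) :=
  Submodule.span ℂ {B | ∃ s : Finset (Fin (2 * n)), s.card = κ ∧ B = majoranaProd s}

/-- The Hermitian operators `i^{⌊κ/2⌋} c^s / √(2^n)`, `|s| = κ`, which form an orthonormal basis of
`𝓑_κ` for the Hilbert–Schmidt inner product. -/
def basisOp {n : ℕ} (s : Finset (Fin (2 * n))) : Op n :=
  (Complex.I ^ (s.card / 2) / ((Real.sqrt (2 ^ n) : ℝ) : ℂ)) • majoranaProd s

/-- The orthogonal projection `M_κ = ∑_j Tr[B_j M] B_j` of `M` onto `𝓑_κ`. -/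
def component {n : ℕ} (κ : ℕ) (M : Op n) : Op n :=
  ∑ s ∈ (Finset.univ : Finset (Fin (2 * n))).powersetCard κ,
    (basisOp s * M).trace • basisOp s

/-- The form `⟨M₁, M₂⟩_Γ = Tr[Γ M₁^† M₂]`. -/
def form {n : ℕ} (Γ M₁ M₂ : Op n) : ℂ := (Γ * M₁ᴴ * M₂).trace

/-- The `κ`-purity `⟨M_κ, M_κ⟩_1`. -/
def purity {n : ℕ} (κ : ℕ) (M : Op n) : ℂ := form 1 (component κ M) (component κ M)

/-- The `κ`-coherence `i^{κ mod 2} ⟨M_κ, M_{2n-κ}⟩_P` (used for `κ ≤ 2n`). -/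
def coherence {n : ℕ} (κ : ℕ) (M : Op n) : ℂ :=
  Complex.I ^ (κ % 2) * form (parity n) (component κ M) (component (2 * n - κ) M)

/-! ### States and the loss function -/

/-- Quantum states: positive semidefinite operators of unit trace. -/
structure IsState {n : ℕ} (ρ : Op n) : Prop where
  posSemidef : ρ.PosSemidef
  trace_eq_one : ρ.trace = 1

/-- The loss function `ℓ_θ(ρ, O) = Tr[U(θ) ρ U(θ)^† O]`. -/
def loss {n L : ℕ} (H : Fin L → Generator n) (ρ O : Op n) (θ : Fin L → ℝ) : ℂ :=
  (circuit H θ * ρ * (circuit H θ)ᴴ * O).trace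

end Matchgate

end

/-! The design property turns the first two moments of the loss into Haar averages over `G`. In the
orthonormal Hermitian basis `basisOp s`, the loss at `g` is `∑ s, orbitCoord ρ s g * coord s O`, so
what is needed is the mean of one orbit coordinate and of a product of two. No classification of the
commutant of `G` is used; the averages follow from left invariance under a few explicit group
elements, together with two invariants.

Up to a factor `i` the generators are exactly the products `rotor a` of the Majorana operators `a`
and `a + 1`. Rotation by `π/2` puts the rotor itself in `G`, and conjugation by it multiplies
`basisOp s` by `-1` exactly when `s` separates `a` from `a + 1`. Hence a first moment vanishes
unless `s` is empty or full (`integral_orbitCoord_eq_zero`), and a second moment at `s, t` vanishes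
unless `t = s` or `t = sᶜ` (`integral_orbitCoord_mul_eq_zero`). Rotation by `π/4` transposes `a` and
`a + 1` in `s` up to sign, so diagonal second moments depend only on `s.card`.

Their sum over all `s` of size `κ` is fixed because `casimir n κ` commutes with every `g ⊗ g`; each
is therefore this sum divided by the binomial coefficient
(`choose_card_mul_integral_orbitCoord_mul`). The same statement for the pair `M`, `M * P` gives the
moments at `s, sᶜ`, since `P` commutes with `G` and sends `basisOp s` to a multiple of `basisOp sᶜ`.
Diagonal terms become purities and complementary terms coherences; the terms at `κ = 0` and `κ = 2n`
add up to the squared mean. -/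

noncomputable section

namespace Matchgate

/-! ### Tensor products of matrices -/

section TensorProduct

variable {m : ℕ} {ι : Type}

theorem tensorProd_mul [Fintype ι] (A B : Fin m → Matrix ι ι ℂ) :
    tensorProd A * tensorProd B = tensorProd fun k => A k * B k := by
  classical
  ext a b
  simp only [tensorProd, Matrix.mul_apply, Matrix.of_apply, Finset.prod_univ_sum,
    Fintype.piFinset_univ, Finset.prod_mul_distrib]

theorem tensorProd_one [DecidableEq ι] :
    (tensorProd fun _ : Fin m => (1 : Matrix ι ι ℂ)) = 1 := by
  ext a b
  by_cases h : a = b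
  · subst h; simp [tensorProd]
  · obtain ⟨k, hk⟩ := Function.ne_iff.mp h
    simp only [tensorProd, Matrix.of_apply, Matrix.one_apply_ne h]
    exact Finset.prod_eq_zero (Finset.mem_univ k) (Matrix.one_apply_ne hk)

theorem tensorProd_smul (s : Fin m → ℂ) (A : Fin m → Matrix ι ι ℂ) :
    (tensorProd fun k => s k • A k) = (∏ k, s k) • tensorProd A := by
  ext a b
  simp [tensorProd, Finset.prod_mul_distrib]

theorem tensorProd_conjTranspose (A : Fin m → Matrix ι ι ℂ) :
    (tensorProd A)ᴴ = tensorProd fun k => (A k)ᴴ := by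
  ext a b
  simp [tensorProd, Matrix.conjTranspose_apply]

theorem tensorProd_trace [Fintype ι] (A : Fin m → Matrix ι ι ℂ) :
    (tensorProd A).trace = ∏ k, (A k).trace := by
  classical
  simp [tensorProd, Matrix.trace, Finset.prod_univ_sum]

theorem tensorProd_mul_comm_smul [Fintype ι] {A B : Fin m → Matrix ι ι ℂ} (s : Fin m → ℂ)
    (h : ∀ k, A k * B k = s k • (B k * A k)) :
    tensorProd A * tensorProd B = (∏ k, s k) • (tensorProd B * tensorProd A) := by
  rw [tensorProd_mul, tensorProd_mul, ← tensorProd_smul]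
  simp only [h]

end TensorProduct

/-! ### Pauli relations -/

section Pauli

theorem pauliX_mul_self : pauliX * pauliX = 1 := by
  ext i j; fin_cases i <;> fin_cases j <;> simp [pauliX, Matrix.mul_apply]

theorem pauliY_mul_self : pauliY * pauliY = 1 := by
  ext i j; fin_cases i <;> fin_cases j <;> simp [pauliY, Matrix.mul_apply]

theorem pauliZ_mul_self : pauliZ * pauliZ = 1 := by
  ext i j; fin_cases i <;> fin_cases j <;> simp [pauliZ, Matrix.mul_apply]

theorem pauliX_mul_pauliY : pauliX * pauliY = Complex.I • pauliZ := by
  ext i j; fin_cases i <;> fin_cases j <;> simp [pauliX, pauliY, pauliZ, Matrix.mul_apply]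

theorem pauliY_mul_pauliX : pauliY * pauliX = (-Complex.I) • pauliZ := by
  ext i j; fin_cases i <;> fin_cases j <;> simp [pauliX, pauliY, pauliZ, Matrix.mul_apply]

theorem pauliY_mul_pauliZ : pauliY * pauliZ = Complex.I • pauliX := by
  ext i j; fin_cases i <;> fin_cases j <;> simp [pauliX, pauliY, pauliZ, Matrix.mul_apply]

theorem pauliZ_mul_pauliY : pauliZ * pauliY = (-Complex.I) • pauliX := by
  ext i j; fin_cases i <;> fin_cases j <;> simp [pauliX, pauliY, pauliZ, Matrix.mul_apply]

theorem pauliX_mul_pauliZ : pauliX * pauliZ = (-1 : ℂ) • (pauliZ * pauliX) := by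
  ext i j; fin_cases i <;> fin_cases j <;> simp [pauliX, pauliZ, Matrix.mul_apply]

theorem pauliX_conjTranspose : pauliXᴴ = pauliX := by
  ext i j; fin_cases i <;> fin_cases j <;> simp [pauliX, Matrix.conjTranspose_apply]

theorem pauliY_conjTranspose : pauliYᴴ = pauliY := by
  ext i j; fin_cases i <;> fin_cases j <;> simp [pauliY, Matrix.conjTranspose_apply]

theorem pauliZ_conjTranspose : pauliZᴴ = pauliZ := by
  ext i j; fin_cases i <;> fin_cases j <;> simp [pauliZ, Matrix.conjTranspose_apply]

end Pauli

/-! ### Clifford relations for Majorana operators and parity -/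

variable {n : ℕ}

/-- The qubit on which the last nontrivial letter of a Majorana operator stands. -/
def site (m : Fin (2 * n)) : Fin n := ⟨(m : ℕ) / 2, by omega⟩

theorem majorana_mul_self (m : Fin (2 * n)) : majorana m * majorana m = 1 := by
  rw [majorana, tensorProd_mul, ← tensorProd_one]
  congr 1
  funext k
  split_ifs <;> simp [pauliX_mul_self, pauliY_mul_self, pauliZ_mul_self]

theorem majorana_conjTranspose (m : Fin (2 * n)) : (majorana m)ᴴ = majorana m := by
  rw [majorana, tensorProd_conjTranspose]
  congr 1
  funext k
  split_ifs <;> simp [pauliX_conjTranspose, pauliY_conjTranspose, pauliZ_conjTranspose]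

/-- Exactly one qubit contributes a sign, the site of `a`: before it both letters are `Z`, after it
`a` has the identity. At that site `X` meets `Y` if the two sites agree, and otherwise `X` or `Y`
meets the `Z` string of `b`. -/
theorem majorana_anticomm_of_lt {a b : Fin (2 * n)} (hab : a < b) :
    majorana a * majorana b = -(majorana b * majorana a) := by
  have hab' : (a : ℕ) < b := hab
  rw [majorana, majorana,
    tensorProd_mul_comm_smul (fun k => if k = site a then (-1 : ℂ) else 1)]
  · simp
  · intro k
    have hk : (k = site a) ↔ (k : ℕ) = (a : ℕ) / 2 := by simp [site, Fin.ext_iff]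
    simp only [hk]
    rcases lt_trichotomy (k : ℕ) ((a : ℕ) / 2) with h | h | h
    · have h1 : (k : ℕ) < (b : ℕ) / 2 := by omega
      simp [h, h1, h.ne]
    · rcases eq_or_ne ((a : ℕ) / 2) ((b : ℕ) / 2) with h2 | h2
      · have h3 : (a : ℕ) % 2 = 0 := by omega
        have h4 : (b : ℕ) % 2 = 1 := by omega
        simp [h, h3, h4, ← h2, pauliX_mul_pauliY, pauliY_mul_pauliX]
      · have h1 : (k : ℕ) < (b : ℕ) / 2 := by omega
        have h5 : (a : ℕ) / 2 < (b : ℕ) / 2 := by omega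
        by_cases h3 : (a : ℕ) % 2 = 0
        · simp [h, h5, h3, pauliX_mul_pauliZ]
        · simp [h, h5, h3, pauliY_mul_pauliZ, pauliZ_mul_pauliY]
    · have h1 : ¬ (k : ℕ) < (a : ℕ) / 2 := by omega
      simp [h1, h.ne']

theorem majorana_anticomm {a b : Fin (2 * n)} (hab : a ≠ b) :
    majorana a * majorana b = -(majorana b * majorana a) := by
  rcases lt_or_gt_of_ne hab with h | h
  · exact majorana_anticomm_of_lt h
  · rw [majorana_anticomm_of_lt h, neg_neg]

theorem parity_mul_majorana (a : Fin (2 * n)) :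
    parity n * majorana a = -(majorana a * parity n) := by
  rw [majorana, parity,
    tensorProd_mul_comm_smul (fun k => if k = site a then (-1 : ℂ) else 1)]
  · simp
  · intro k
    have hk : (k = site a) ↔ (k : ℕ) = (a : ℕ) / 2 := by simp [site, Fin.ext_iff]
    simp only [hk]
    rcases lt_trichotomy (k : ℕ) ((a : ℕ) / 2) with h | h | h
    · simp [h, h.ne]
    · by_cases h3 : (a : ℕ) % 2 = 0
      · simp [h, h3, pauliX_mul_pauliZ]
      · simp [h, h3, pauliY_mul_pauliZ, pauliZ_mul_pauliY]
    · have h1 : ¬ (k : ℕ) < (a : ℕ) / 2 := by omega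
      simp [h1, h.ne']

theorem parity_mul_self : parity n * parity n = 1 := by
  rw [parity, tensorProd_mul, ← tensorProd_one]
  simp [pauliZ_mul_self]

/-! ### Circuit generators as products of neighbouring Majorana operators -/

theorem I_smul_toOp_z (i : Fin n) :
    Complex.I • (Generator.z i).toOp =
      majorana ⟨2 * i, by omega⟩ * majorana ⟨2 * i + 1, by omega⟩ := by
  -- The scalar `i` is written as a product over qubits with a single nontrivial factor, so that it
  -- can be absorbed into the tensor factor at qubit `i`.
  have hs : (∏ k : Fin n, if k = i then Complex.I else 1) = Complex.I := by simp
  rw [majorana, majorana, tensorProd_mul, Generator.toOp]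
  conv_lhs => rw [← hs]
  rw [← tensorProd_smul]
  congr 1
  funext k
  have h1 : (2 * (i : ℕ)) / 2 = i := by omega
  have h2 : (2 * (i : ℕ) + 1) / 2 = i := by omega
  have h3 : (2 * (i : ℕ) + 1) % 2 = 1 := by omega
  simp only [h1, h2, h3, Fin.ext_iff]
  rcases lt_trichotomy (k : ℕ) i with h | h | h
  · simp [h, h.ne, pauliZ_mul_self]
  · simp [h, pauliX_mul_pauliY]
  · simp [h.not_gt, h.ne']

/-- The `Z` strings cancel up to qubit `i`; there `Y Z = i X`, and the next qubit keeps its `X`. -/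
theorem I_smul_toOp_xx (i : Fin n) (hi : (i : ℕ) + 1 < n) :
    Complex.I • (Generator.xx i hi).toOp =
      majorana ⟨2 * i + 1, by omega⟩ * majorana ⟨2 * i + 1 + 1, by omega⟩ := by
  have hs : (∏ k : Fin n, if k = i then Complex.I else 1) = Complex.I := by simp
  rw [majorana, majorana, tensorProd_mul, Generator.toOp]
  conv_lhs => rw [← hs]
  rw [← tensorProd_smul]
  congr 1
  funext k
  have h1 : (2 * (i : ℕ) + 1 + 1) / 2 = i + 1 := by omega
  have h2 : (2 * (i : ℕ) + 1) / 2 = i := by omega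
  have h3 : (2 * (i : ℕ) + 1) % 2 = 1 := by omega
  have h4 : (2 * (i : ℕ) + 1 + 1) % 2 = 0 := by omega
  simp only [h1, h2, h3, h4, Fin.ext_iff]
  rcases lt_trichotomy (k : ℕ) i with h | h | h
  · have : (k : ℕ) < i + 1 := by omega
    have h' : (k : ℕ) ≠ i + 1 := by omega
    simp [h, h.ne, this, h', pauliZ_mul_self]
  · simp [h, pauliY_mul_pauliZ]
  · by_cases h' : (k : ℕ) = i + 1
    · simp [h']
    · have : ¬ (k : ℕ) < i + 1 := by omega
      simp [h.not_gt, h.ne', h', this]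

/-- The product of two neighbouring Majorana operators. -/
def rotor (a : ℕ) (ha : a + 1 < 2 * n) : Op n :=
  majorana ⟨a, by omega⟩ * majorana ⟨a + 1, ha⟩

theorem exists_I_smul_toOp_eq_rotor (H : Generator n) :
    ∃ (a : ℕ) (ha : a + 1 < 2 * n), Complex.I • H.toOp = rotor a ha := by
  cases H with
  | z i => exact ⟨2 * i, by omega, I_smul_toOp_z i⟩
  | xx i hi => exact ⟨2 * i + 1, by omega, I_smul_toOp_xx i hi⟩

theorem exists_rotor_eq_I_smul_toOp (a : ℕ) (ha : a + 1 < 2 * n) :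
    ∃ H : Generator n, rotor a ha = Complex.I • H.toOp := by
  rcases Nat.even_or_odd' a with ⟨i, rfl | rfl⟩
  · exact ⟨.z ⟨i, by omega⟩, (I_smul_toOp_z ⟨i, by omega⟩).symm⟩
  · exact ⟨.xx ⟨i, by omega⟩ (by simp; omega), (I_smul_toOp_xx ⟨i, by omega⟩ (by simp; omega)).symm⟩

/-! ### Products of Majorana operators -/

/-- The sign by which the Majorana operator `b` and the Majorana product over `s` commute. -/
def exchangeSign (b : Fin (2 * n)) (s : Finset (Fin (2 * n))) : ℂ :=
  (-1) ^ (s.card + if b ∈ s then 1 else 0)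

theorem neg_one_pow_mul_self (k : ℕ) : (-1 : ℂ) ^ k * (-1) ^ k = 1 := by
  rw [← pow_add, Even.neg_one_pow ⟨k, rfl⟩]

theorem majorana_mul_list_prod (b : Fin (2 * n)) (l : List (Fin (2 * n))) :
    majorana b * (l.map majorana).prod =
      ((-1 : ℂ) ^ (l.length + l.count b)) • ((l.map majorana).prod * majorana b) := by
  induction l with
  | nil => simp
  | cons a l ih =>
    rw [List.map_cons, List.prod_cons, List.length_cons, List.count_cons]
    by_cases h : a = b
    · subst h
      conv_lhs => rw [ih, mul_smul_comm, ← mul_assoc]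
      rw [beq_self_eq_true, if_pos rfl,
        show l.length + 1 + (l.count a + 1) = l.length + l.count a + 2 by ring, pow_add _ _ 2]
      simp
    · rw [← mul_assoc, majorana_anticomm (Ne.symm h), neg_mul, mul_assoc, ih, mul_smul_comm,
        ← mul_assoc, ← neg_smul]
      simp [h, pow_add]

theorem majorana_mul_majoranaProd (b : Fin (2 * n)) (s : Finset (Fin (2 * n))) :
    majorana b * majoranaProd s = exchangeSign b s • (majoranaProd s * majorana b) := by
  rw [majoranaProd, majorana_mul_list_prod, exchangeSign, Finset.length_sort,
    (Finset.sort_nodup s (· ≤ ·)).count]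
  simp

/-- Reversal costs one sign per pair of letters, and `k(k-1)/2` has the same parity as `⌊k/2⌋`. -/
theorem reverse_list_prod {l : List (Fin (2 * n))} (hl : l.Nodup) :
    (l.reverse.map majorana).prod = ((-1 : ℂ) ^ (l.length / 2)) • (l.map majorana).prod := by
  induction l with
  | nil => simp
  | cons a l ih =>
    have ha : l.count a = 0 := List.count_eq_zero.2 (List.nodup_cons.1 hl).1
    rw [List.reverse_cons, List.map_append, List.prod_append, ih (List.nodup_cons.1 hl).2]
    simp only [List.map_cons, List.map_nil, List.prod_cons, List.prod_nil, mul_one,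
      List.length_cons]
    rw [majorana_mul_list_prod, ha, add_zero, smul_smul, smul_mul_assoc]
    congr 1
    rcases Nat.even_or_odd' l.length with ⟨k, hk | hk⟩
    · rw [hk, show (2 * k + 1) / 2 = k by omega, show 2 * k / 2 = k by omega]
      simp [pow_mul]
    · rw [hk, show (2 * k + 1 + 1) / 2 = k + 1 by omega, show (2 * k + 1) / 2 = k by omega]
      simp [pow_succ, pow_mul]

theorem list_prod_conjTranspose (l : List (Fin (2 * n))) :
    ((l.map majorana).prod)ᴴ = (l.reverse.map majorana).prod := by
  induction l with
  | nil => simp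
  | cons a l ih => simp [Matrix.conjTranspose_mul, ih, majorana_conjTranspose]

theorem list_prod_mul_reverse (l : List (Fin (2 * n))) :
    (l.map majorana).prod * (l.reverse.map majorana).prod = 1 := by
  induction l with
  | nil => simp
  | cons a l ih =>
    simp only [List.map_cons, List.prod_cons, List.reverse_cons, List.map_append,
      List.prod_append, List.map_nil, List.prod_nil, mul_one]
    rw [mul_assoc, ← mul_assoc _ _ (majorana a), ih, one_mul, majorana_mul_self]

theorem majoranaProd_conjTranspose (s : Finset (Fin (2 * n))) :
    (majoranaProd s)ᴴ = ((-1 : ℂ) ^ (s.card / 2)) • majoranaProd s := by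
  rw [majoranaProd, list_prod_conjTranspose, reverse_list_prod (Finset.sort_nodup _ _),
    Finset.length_sort]

theorem majoranaProd_mul_self (s : Finset (Fin (2 * n))) :
    majoranaProd s * majoranaProd s = ((-1 : ℂ) ^ (s.card / 2)) • (1 : Op n) := by
  have h := list_prod_mul_reverse (s.sort (· ≤ ·))
  rw [← list_prod_conjTranspose] at h
  change majoranaProd s * (majoranaProd s)ᴴ = 1 at h
  rw [majoranaProd_conjTranspose, mul_smul_comm] at h
  rw [← h, smul_smul, neg_one_pow_mul_self, one_smul]

/-! ### The orthonormal basis and its weights -/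

/-- The coefficient in the definition of `basisOp`. -/
def basisCoeff (n k : ℕ) : ℂ := Complex.I ^ (k / 2) / ((Real.sqrt (2 ^ n) : ℝ) : ℂ)

theorem basisOp_eq (s : Finset (Fin (2 * n))) :
    basisOp s = basisCoeff n s.card • majoranaProd s := rfl

theorem sqrt_two_pow_mul_self (n : ℕ) :
    ((Real.sqrt (2 ^ n) : ℝ) : ℂ) * ((Real.sqrt (2 ^ n) : ℝ) : ℂ) = 2 ^ n := by
  rw [← Complex.ofReal_mul, Real.mul_self_sqrt (by positivity)]
  simp

theorem basisCoeff_ne_zero (n k : ℕ) : basisCoeff n k ≠ 0 := by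
  have : ((Real.sqrt (2 ^ n) : ℝ) : ℂ) ≠ 0 := by
    intro h
    have := sqrt_two_pow_mul_self n
    rw [h, mul_zero] at this
    exact pow_ne_zero n two_ne_zero this.symm
  exact div_ne_zero (pow_ne_zero _ Complex.I_ne_zero) this

theorem basisCoeff_mul_self (n k : ℕ) :
    basisCoeff n k * basisCoeff n k = (-1) ^ (k / 2) / 2 ^ n := by
  rw [basisCoeff, div_mul_div_comm, sqrt_two_pow_mul_self, ← mul_pow, Complex.I_mul_I]

theorem star_basisCoeff (n k : ℕ) :
    star (basisCoeff n k) = (-1) ^ (k / 2) * basisCoeff n k := by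
  rw [basisCoeff, Complex.star_def, map_div₀, map_pow, Complex.conj_I, Complex.conj_ofReal,
    neg_pow, mul_div_assoc]

theorem basisOp_conjTranspose (s : Finset (Fin (2 * n))) : (basisOp s)ᴴ = basisOp s := by
  rw [basisOp_eq, Matrix.conjTranspose_smul, star_basisCoeff, majoranaProd_conjTranspose,
    smul_smul, mul_right_comm, neg_one_pow_mul_self, one_mul]

theorem basisOp_mul_self (s : Finset (Fin (2 * n))) :
    basisOp s * basisOp s = ((2 : ℂ) ^ n)⁻¹ • (1 : Op n) := by
  rw [basisOp_eq, smul_mul_smul_comm, basisCoeff_mul_self, majoranaProd_mul_self, smul_smul,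
    div_mul_eq_mul_div, neg_one_pow_mul_self, one_div]

theorem majorana_mul_basisOp (b : Fin (2 * n)) (s : Finset (Fin (2 * n))) :
    majorana b * basisOp s = exchangeSign b s • (basisOp s * majorana b) := by
  rw [basisOp_eq, mul_smul_comm, majorana_mul_majoranaProd, smul_mul_assoc, smul_comm]

theorem trace_one_op : (1 : Op n).trace = 2 ^ n := by
  simp [Matrix.trace_one]

theorem trace_basisOp_mul_self (s : Finset (Fin (2 * n))) : (basisOp s * basisOp s).trace = 1 := by
  rw [basisOp_mul_self, Matrix.trace_smul, trace_one_op, smul_eq_mul,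
    inv_mul_cancel₀ (pow_ne_zero n two_ne_zero)]

/-- Conjugation by the involution `majorana b` preserves the trace and sends `M` to `-M`. -/
theorem trace_eq_zero_of_anticomm {M : Op n} (b : Fin (2 * n))
    (h : majorana b * M = -(M * majorana b)) : M.trace = 0 := by
  have h1 : M.trace = (majorana b * (majorana b * M)).trace := by
    rw [← mul_assoc, majorana_mul_self, one_mul]
  rw [h, mul_neg, Matrix.trace_neg, ← mul_assoc, Matrix.trace_mul_comm, ← mul_assoc,
    majorana_mul_self, one_mul] at h1
  exact self_eq_neg.mp h1

/-- If `s.card + t.card` is even, any `b` in exactly one of the sets works. If it is odd, a `b` on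
which memberships agree is needed; one is missing only for `t = sᶜ`, where the cardinalities add up
to the even number `2n`. -/
theorem exists_exchangeSign_mul_eq_neg_one {s t : Finset (Fin (2 * n))} (h : s ≠ t) :
    ∃ b, exchangeSign b s * exchangeSign b t = -1 := by
  simp only [exchangeSign, ← pow_add]
  rcases Nat.even_or_odd (s.card + t.card) with he | ho
  · obtain ⟨b, hb⟩ : ∃ b, ¬ (b ∈ s ↔ b ∈ t) := by
      by_contra! hc
      exact h (Finset.ext hc)
    refine ⟨b, Odd.neg_one_pow ?_⟩
    by_cases h1 : b ∈ s <;> by_cases h2 : b ∈ t <;> (simp_all; try grind)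
  · obtain ⟨b, hb⟩ : ∃ b, b ∈ s ↔ b ∈ t := by
      by_contra! hc
      have hst : t = sᶜ := by
        ext b
        rw [Finset.mem_compl]
        have := hc b
        tauto
      have h2 : s.card ≤ 2 * n := by simpa using Finset.card_le_univ s
      rw [hst, Finset.card_compl, Fintype.card_fin, Nat.add_sub_cancel' h2] at ho
      exact (Nat.not_odd_iff_even.2 (even_two_mul n)) ho
    refine ⟨b, Odd.neg_one_pow ?_⟩
    by_cases h2 : b ∈ t <;> grind

/-- An operator has weight `s` if it commutes with the Majorana operators up to the same signs as
the Majorana product over `s`. -/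
def HasWeight (s : Finset (Fin (2 * n))) (M : Op n) : Prop :=
  ∀ b, majorana b * M = exchangeSign b s • (M * majorana b)

theorem hasWeight_basisOp (s : Finset (Fin (2 * n))) : HasWeight s (basisOp s) :=
  fun b => majorana_mul_basisOp b s

theorem HasWeight.trace_basisOp_mul {s t : Finset (Fin (2 * n))} {M : Op n} (hM : HasWeight s M)
    (h : t ≠ s) : (basisOp t * M).trace = 0 := by
  obtain ⟨b, hb⟩ := exists_exchangeSign_mul_eq_neg_one h
  refine trace_eq_zero_of_anticomm b ?_
  rw [← mul_assoc, majorana_mul_basisOp, smul_mul_assoc, mul_assoc, hM b, mul_smul_comm,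
    smul_smul, hb, neg_one_smul, mul_assoc]

theorem trace_basisOp_mul_basisOp (s t : Finset (Fin (2 * n))) :
    (basisOp s * basisOp t).trace = if s = t then 1 else 0 := by
  split_ifs with h
  · rw [h, trace_basisOp_mul_self]
  · exact (hasWeight_basisOp t).trace_basisOp_mul h

theorem linearIndependent_basisOp :
    LinearIndependent ℂ (basisOp : Finset (Fin (2 * n)) → Op n) := by
  rw [Fintype.linearIndependent_iff]
  intro c hc s
  have h := congrArg (fun M => (basisOp s * M).trace) hc
  simpa [Finset.mul_sum, Matrix.trace_sum, trace_basisOp_mul_basisOp] using h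

/-- There are `2^(2n)` independent vectors, as many as the dimension `2^n * 2^n`. -/
theorem span_range_basisOp :
    Submodule.span ℂ (Set.range (basisOp : Finset (Fin (2 * n)) → Op n)) = ⊤ := by
  refine LinearIndependent.span_eq_top_of_card_eq_finrank' linearIndependent_basisOp ?_
  rw [Fintype.card_finset, Module.finrank_matrix]
  simp [two_mul, pow_add]

/-- The coefficients of an operator with respect to the basis `basisOp`. -/
def coord (s : Finset (Fin (2 * n))) (M : Op n) : ℂ := (basisOp s * M).trace

theorem sum_coord_smul_basisOp (M : Op n) : ∑ s, coord s M • basisOp s = M := by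
  have hM : M ∈ Submodule.span ℂ (Set.range (basisOp : Finset (Fin (2 * n)) → Op n)) := by
    rw [span_range_basisOp]; trivial
  obtain ⟨c, rfl⟩ := (Submodule.mem_span_range_iff_exists_fun ℂ).1 hM
  refine Finset.sum_congr rfl fun s _ => ?_
  congr 1
  simp [coord, Finset.mul_sum, Matrix.trace_sum, trace_basisOp_mul_basisOp]

theorem trace_mul_eq_sum_coord (M N : Op n) :
    (M * N).trace = ∑ s, coord s M * coord s N := by
  conv_lhs => rw [← sum_coord_smul_basisOp M]
  simp [Finset.sum_mul, Matrix.trace_sum, coord]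

/-- Weights separate subsets, so weight spaces are lines. This identifies products of basis
operators up to a scalar without reordering Majorana factors. -/
theorem HasWeight.eq_smul {s : Finset (Fin (2 * n))} {M : Op n} (hM : HasWeight s M) :
    M = coord s M • basisOp s := by
  conv_lhs => rw [← sum_coord_smul_basisOp M]
  refine Finset.sum_eq_single s (fun t _ ht => ?_) (by simp)
  rw [coord, hM.trace_basisOp_mul ht, zero_smul]

theorem coord_conjTranspose (s : Finset (Fin (2 * n))) (M : Op n) :
    coord s Mᴴ = star (coord s M) := by
  rw [coord, coord, ← Matrix.trace_conjTranspose, Matrix.conjTranspose_mul,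
    basisOp_conjTranspose, Matrix.trace_mul_comm]

/-! ### Parity and complementation -/

theorem exchangeSign_compl (b : Fin (2 * n)) (s : Finset (Fin (2 * n))) :
    exchangeSign b sᶜ = -exchangeSign b s := by
  have h2 : s.card ≤ 2 * n := by simpa using Finset.card_le_univ s
  have h3 : sᶜ.card = 2 * n - s.card := by rw [Finset.card_compl, Fintype.card_fin]
  rw [exchangeSign, exchangeSign, h3, ← mul_neg_one ((-1 : ℂ) ^ _), ← pow_succ]
  have h4 : ∀ i j : ℕ, i % 2 = j % 2 → (-1 : ℂ) ^ i = (-1) ^ j := by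
    intro i j hij
    rw [neg_one_pow_eq_pow_mod_two, hij, ← neg_one_pow_eq_pow_mod_two]
  apply h4
  by_cases h : b ∈ s <;> simp [h] <;> omega

theorem hasWeight_parity_mul_basisOp (s : Finset (Fin (2 * n))) :
    HasWeight sᶜ (parity n * basisOp s) := by
  intro b
  have h : majorana b * parity n = -(parity n * majorana b) := by
    rw [parity_mul_majorana, neg_neg]
  rw [← mul_assoc, h, neg_mul, mul_assoc, majorana_mul_basisOp, exchangeSign_compl, mul_smul_comm,
    neg_smul, mul_assoc]

/-- The phase in `P B_s = η_s B_{sᶜ}`. -/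
def parityPhase (s : Finset (Fin (2 * n))) : ℂ := coord sᶜ (parity n * basisOp s)

theorem parity_mul_basisOp (s : Finset (Fin (2 * n))) :
    parity n * basisOp s = parityPhase s • basisOp sᶜ :=
  (hasWeight_parity_mul_basisOp s).eq_smul

theorem parity_mul_list_prod (l : List (Fin (2 * n))) :
    parity n * (l.map majorana).prod =
      ((-1 : ℂ) ^ l.length) • ((l.map majorana).prod * parity n) := by
  induction l with
  | nil => simp
  | cons a l ih =>
    rw [List.map_cons, List.prod_cons, List.length_cons, ← mul_assoc, parity_mul_majorana, neg_mul,
      mul_assoc, ih, mul_smul_comm, ← neg_smul, pow_succ, mul_neg_one, mul_assoc]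

theorem parity_mul_basisOp_comm (s : Finset (Fin (2 * n))) :
    parity n * basisOp s = ((-1 : ℂ) ^ s.card) • (basisOp s * parity n) := by
  rw [basisOp_eq, majoranaProd, mul_smul_comm, parity_mul_list_prod, Finset.length_sort,
    smul_mul_assoc, smul_comm]

/-- Compare traces of the square of `P * basisOp s`, using `P² = 1`. The phase itself is never
computed; its square suffices. -/
theorem parityPhase_mul_self (s : Finset (Fin (2 * n))) :
    parityPhase s * parityPhase s = (-1) ^ s.card := by
  have h1 : (parity n * basisOp s) * (parity n * basisOp s) =
      (-1 : ℂ) ^ s.card • (basisOp s * basisOp s) := by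
    nth_rewrite 1 [parity_mul_basisOp_comm]
    rw [smul_mul_assoc, mul_assoc, ← mul_assoc (parity n), parity_mul_self, one_mul]
  rw [parity_mul_basisOp, smul_mul_smul_comm] at h1
  have h2 := congrArg Matrix.trace h1
  simpa [Matrix.trace_smul, trace_basisOp_mul_self] using h2

/-! ### Exponentials and Kronecker sums -/

open scoped Kronecker

attribute [local instance 100] LieRing.ofAssociativeRing

theorem exp_map_matrix {m k : Type*} [Fintype m] [DecidableEq m] [Fintype k] [DecidableEq k]
    (f : Matrix m m ℂ →+* Matrix k k ℂ) (hf : Continuous f) (A : Matrix m m ℂ) :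
    f (NormedSpace.exp A) = NormedSpace.exp (f A) :=
  open scoped Norms.Operator in NormedSpace.map_exp f hf A

theorem exp_map_complex {k : Type*} [Fintype k] [DecidableEq k]
    (f : ℂ →+* Matrix k k ℂ) (hf : Continuous f) (z : ℂ) :
    f (NormedSpace.exp z) = NormedSpace.exp (f z) :=
  open scoped Norms.Operator in NormedSpace.map_exp f hf z

/-- A square root `J` of `-1` gives a continuous ring homomorphism from `ℂ` with `I ↦ J`, which
transports Euler's formula. -/
theorem exp_real_smul_of_mul_self_eq_neg_one {k : Type*} [Fintype k] [DecidableEq k]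
    {J : Matrix k k ℂ} (hJ : J * J = -1) (t : ℝ) :
    NormedSpace.exp (t • J) = (Real.cos t : ℂ) • (1 : Matrix k k ℂ) + (Real.sin t : ℂ) • J := by
  have hc : Continuous (Complex.liftAux J hJ : ℂ →+* Matrix k k ℂ) := by
    have : ∀ z, (Complex.liftAux J hJ : ℂ →+* Matrix k k ℂ) z =
        z.re • (1 : Matrix k k ℂ) + z.im • J := by
      intro z
      simp [Algebra.algebraMap_eq_smul_one]
    simp only [funext this]
    fun_prop
  have h := exp_map_complex _ hc ((t : ℂ) * Complex.I)
  rw [← Complex.exp_eq_exp_ℂ, Complex.exp_mul_I, ← Complex.ofReal_cos, ← Complex.ofReal_sin] at h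
  have hl : (Complex.liftAux J hJ : ℂ →+* Matrix k k ℂ) ((t : ℂ) * Complex.I) = t • J := by
    simp
  rw [hl] at h
  rw [← h]
  simp [Algebra.algebraMap_eq_smul_one, -Complex.ofReal_cos, -Complex.ofReal_sin]

theorem commute_of_inverse {R : Type*} [Monoid R] {u v x : R} (huv : u * v = 1) (hvu : v * u = 1)
    (h : Commute u x) : Commute v x := by
  calc v * x = v * x * (u * v) := by rw [huv, mul_one]
    _ = v * (u * x) * v := by rw [h.eq]; simp only [mul_assoc]
    _ = x * v := by rw [← mul_assoc, hvu, one_mul]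

section KroneckerSum

variable {m : Type*} [Fintype m] [DecidableEq m]

/-- The ring homomorphism `A ↦ A ⊗ 1`. -/
def kroneckerLeft : Matrix m m ℂ →+* Matrix (m × m) (m × m) ℂ where
  toFun A := A ⊗ₖ 1
  map_one' := Matrix.one_kronecker_one
  map_mul' A B := by rw [← Matrix.mul_kronecker_mul, one_mul]
  map_zero' := Matrix.zero_kronecker _
  map_add' A B := Matrix.add_kronecker _ _ _

/-- The ring homomorphism `A ↦ 1 ⊗ A`. -/
def kroneckerRight : Matrix m m ℂ →+* Matrix (m × m) (m × m) ℂ where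
  toFun A := 1 ⊗ₖ A
  map_one' := Matrix.one_kronecker_one
  map_mul' A B := by rw [← Matrix.mul_kronecker_mul, one_mul]
  map_zero' := Matrix.kronecker_zero _
  map_add' A B := Matrix.kronecker_add _ _ _

theorem kroneckerLeft_apply (A : Matrix m m ℂ) : kroneckerLeft A = A ⊗ₖ 1 := rfl

theorem kroneckerRight_apply (A : Matrix m m ℂ) : kroneckerRight A = 1 ⊗ₖ A := rfl

theorem continuous_kroneckerLeft : Continuous (kroneckerLeft (m := m)) :=
  continuous_matrix fun i j => by
    simp only [kroneckerLeft_apply, Matrix.kroneckerMap_apply]; fun_prop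

theorem continuous_kroneckerRight : Continuous (kroneckerRight (m := m)) :=
  continuous_matrix fun i j => by
    simp only [kroneckerRight_apply, Matrix.kroneckerMap_apply]; fun_prop

theorem kroneckerLeft_mul_kroneckerRight (A B : Matrix m m ℂ) :
    kroneckerLeft A * kroneckerRight B = A ⊗ₖ B := by
  rw [kroneckerLeft_apply, kroneckerRight_apply, ← Matrix.mul_kronecker_mul, one_mul, mul_one]

theorem kroneckerRight_mul_kroneckerLeft (A B : Matrix m m ℂ) :
    kroneckerRight B * kroneckerLeft A = A ⊗ₖ B := by
  rw [kroneckerLeft_apply, kroneckerRight_apply, ← Matrix.mul_kronecker_mul, one_mul, mul_one]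

/-- The operator `A ⊗ 1 + 1 ⊗ A`. -/
def kroneckerSum (A : Matrix m m ℂ) : Matrix (m × m) (m × m) ℂ :=
  kroneckerLeft A + kroneckerRight A

theorem exp_kroneckerSum (A : Matrix m m ℂ) :
    NormedSpace.exp (kroneckerSum A) = NormedSpace.exp A ⊗ₖ NormedSpace.exp A := by
  have hc : Commute (kroneckerLeft A) (kroneckerRight A) := by
    rw [Commute, SemiconjBy, kroneckerLeft_mul_kroneckerRight, kroneckerRight_mul_kroneckerLeft]
  rw [kroneckerSum, Matrix.exp_add_of_commute _ _ hc, ← exp_map_matrix _ continuous_kroneckerLeft,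
    ← exp_map_matrix _ continuous_kroneckerRight, kroneckerLeft_mul_kroneckerRight]

theorem kroneckerSum_lie (A B : Matrix m m ℂ) :
    kroneckerSum (A * B - B * A) =
      kroneckerSum A * kroneckerSum B - kroneckerSum B * kroneckerSum A := by
  simp only [kroneckerSum, map_sub, map_mul, mul_add, add_mul, kroneckerLeft_mul_kroneckerRight,
    kroneckerRight_mul_kroneckerLeft]
  abel

end KroneckerSum

/-- Since `f` respects commutators, the `A` with `f A` commuting with `x` form a real Lie
subalgebra, so generators suffice. It serves for `P` with `f` the identity, and for the Casimir
operator with `f` the Kronecker sum. -/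
theorem commute_of_mem_dla {R : Type*} [Ring R] [Module ℝ R] [IsScalarTower ℝ R R]
    [SMulCommClass ℝ R R] (f : Op n →ₗ[ℝ] R)
    (hf : ∀ A B, f (A * B - B * A) = f A * f B - f B * f A) {x : R}
    (hx : ∀ (a : ℕ) (ha : a + 1 < 2 * n), Commute (f (rotor a ha)) x) {A : Op n}
    (hA : A ∈ dla n) : Commute (f A) x := by
  induction hA using LieSubalgebra.lieSpan_induction with
  | mem A h =>
    obtain ⟨H, rfl⟩ := h
    obtain ⟨a, ha, h⟩ := exists_I_smul_toOp_eq_rotor H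
    rw [h]
    exact hx a ha
  | zero => rw [map_zero]; exact Commute.zero_left _
  | add A B _ _ hA hB => rw [map_add]; exact hA.add_left hB
  | smul r A _ hA => rw [map_smul]; exact hA.smul_left r
  | lie A B _ _ hA hB =>
    rw [Ring.lie_def, hf]
    exact (hA.mul_left hB).sub_left (hB.mul_left hA)

/-! ### Action of rotors on the basis -/

theorem rotor_mul_self (a : ℕ) (ha : a + 1 < 2 * n) : rotor a ha * rotor a ha = -1 := by
  have hne : (⟨a + 1, ha⟩ : Fin (2 * n)) ≠ ⟨a, by omega⟩ := by simp [Fin.ext_iff]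
  rw [rotor, mul_assoc, ← mul_assoc (majorana ⟨a + 1, ha⟩), majorana_anticomm hne, neg_mul,
    mul_assoc, majorana_mul_self, mul_one, mul_neg, majorana_mul_self]

theorem rotor_conjTranspose (a : ℕ) (ha : a + 1 < 2 * n) : (rotor a ha)ᴴ = -rotor a ha := by
  have hne : (⟨a + 1, ha⟩ : Fin (2 * n)) ≠ ⟨a, by omega⟩ := by simp [Fin.ext_iff]
  rw [rotor, Matrix.conjTranspose_mul, majorana_conjTranspose, majorana_conjTranspose,
    majorana_anticomm hne]

theorem commute_rotor_parity (a : ℕ) (ha : a + 1 < 2 * n) : Commute (rotor a ha) (parity n) := by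
  rw [commute_iff_eq, eq_comm, rotor, ← mul_assoc, parity_mul_majorana, neg_mul, mul_assoc,
    parity_mul_majorana, mul_neg, neg_neg, mul_assoc]

/-- The sign by which the product of the Majorana operators `a` and `a + 1` commutes with the
Majorana product over `s`. -/
def rotorSign (a : ℕ) (ha : a + 1 < 2 * n) (s : Finset (Fin (2 * n))) : ℂ :=
  exchangeSign ⟨a, by omega⟩ s * exchangeSign ⟨a + 1, ha⟩ s

theorem rotor_mul_basisOp (a : ℕ) (ha : a + 1 < 2 * n) (s : Finset (Fin (2 * n))) :
    rotor a ha * basisOp s = rotorSign a ha s • (basisOp s * rotor a ha) := by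
  rw [rotor, mul_assoc, majorana_mul_basisOp, mul_smul_comm, ← mul_assoc, majorana_mul_basisOp,
    smul_mul_assoc, smul_smul, mul_assoc, mul_comm (exchangeSign _ _), rotorSign]

theorem rotorSign_eq (a : ℕ) (ha : a + 1 < 2 * n) (s : Finset (Fin (2 * n))) :
    rotorSign a ha s =
      if ((⟨a, by omega⟩ : Fin (2 * n)) ∈ s ↔ (⟨a + 1, ha⟩ : Fin (2 * n)) ∈ s) then 1 else -1 := by
  rw [rotorSign, exchangeSign, exchangeSign, pow_add, pow_add, mul_mul_mul_comm,
    neg_one_pow_mul_self, one_mul]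
  split_ifs <;> simp_all

/-- The transposition of `a` and `a + 1`. -/
def adjSwap (a : ℕ) (ha : a + 1 < 2 * n) : Equiv.Perm (Fin (2 * n)) :=
  Equiv.swap ⟨a, by omega⟩ ⟨a + 1, ha⟩

/-- The image of a set of indices under the transposition of `a` and `a + 1`. -/
def swapSet (a : ℕ) (ha : a + 1 < 2 * n) (s : Finset (Fin (2 * n))) : Finset (Fin (2 * n)) :=
  s.map (adjSwap a ha).toEmbedding

theorem mem_swapSet {a : ℕ} {ha : a + 1 < 2 * n} {s : Finset (Fin (2 * n))} {b : Fin (2 * n)} :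
    b ∈ swapSet a ha s ↔ adjSwap a ha b ∈ s := by
  rw [swapSet, Finset.mem_map_equiv, adjSwap, Equiv.symm_swap]

theorem card_swapSet (a : ℕ) (ha : a + 1 < 2 * n) (s : Finset (Fin (2 * n))) :
    (swapSet a ha s).card = s.card := Finset.card_map _

theorem swapSet_swapSet (a : ℕ) (ha : a + 1 < 2 * n) (s : Finset (Fin (2 * n))) :
    swapSet a ha (swapSet a ha s) = s := by
  ext b
  rw [mem_swapSet, mem_swapSet, adjSwap, Equiv.swap_apply_self]

theorem swapSet_eq_self {a : ℕ} {ha : a + 1 < 2 * n} {s : Finset (Fin (2 * n))}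
    (h : (⟨a, by omega⟩ : Fin (2 * n)) ∈ s ↔ (⟨a + 1, ha⟩ : Fin (2 * n)) ∈ s) :
    swapSet a ha s = s := by
  ext b
  rw [mem_swapSet, adjSwap, Equiv.swap_apply_def]
  split_ifs with h1 h2
  · rw [h1, h]
  · rw [h2, h]
  · rfl

theorem exchangeSign_swapSet {a : ℕ} {ha : a + 1 < 2 * n} {s : Finset (Fin (2 * n))}
    (h : ¬ ((⟨a, by omega⟩ : Fin (2 * n)) ∈ s ↔ (⟨a + 1, ha⟩ : Fin (2 * n)) ∈ s))
    (b : Fin (2 * n)) :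
    exchangeSign b (swapSet a ha s) =
      (if b = ⟨a, by omega⟩ ∨ b = ⟨a + 1, ha⟩ then -1 else 1) * exchangeSign b s := by
  rw [exchangeSign, exchangeSign, card_swapSet, pow_add, pow_add, mul_left_comm]
  congr 1
  simp only [mem_swapSet, adjSwap, Equiv.swap_apply_def]
  by_cases h1 : b = ⟨a, by omega⟩
  · subst h1
    by_cases h3 : (⟨a + 1, ha⟩ : Fin (2 * n)) ∈ s <;> simp_all
  · by_cases h2 : b = ⟨a + 1, ha⟩
    · subst h2
      by_cases h3 : (⟨a + 1, ha⟩ : Fin (2 * n)) ∈ s <;> simp_all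
    · simp [h1, h2]

theorem majorana_mul_rotor (b : Fin (2 * n)) (a : ℕ) (ha : a + 1 < 2 * n) :
    majorana b * rotor a ha =
      (if b = ⟨a, by omega⟩ ∨ b = ⟨a + 1, ha⟩ then (-1 : ℂ) else 1) •
        (rotor a ha * majorana b) := by
  have hne : (⟨a, by omega⟩ : Fin (2 * n)) ≠ ⟨a + 1, ha⟩ := by simp [Fin.ext_iff]
  have key : ∀ c : Fin (2 * n), majorana b * majorana c =
      (if b = c then (1 : ℂ) else -1) • (majorana c * majorana b) := by
    intro c
    split_ifs with h
    · rw [h, one_smul]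
    · rw [majorana_anticomm h, neg_one_smul]
  rw [rotor, ← mul_assoc, key, smul_mul_assoc, mul_assoc, key, mul_smul_comm, smul_smul, mul_assoc]
  congr 1
  by_cases h1 : b = ⟨a, by omega⟩
  · rw [h1]; simp
  · by_cases h2 : b = ⟨a + 1, ha⟩
    · rw [h2]; simp
    · simp [h1, h2]

/-- Multiplication by the rotor toggles membership of both `a` and `a + 1`; when exactly one lies in
`s`, this is the transposition. -/
theorem hasWeight_rotor_mul_basisOp {a : ℕ} {ha : a + 1 < 2 * n} {s : Finset (Fin (2 * n))}
    (h : ¬ ((⟨a, by omega⟩ : Fin (2 * n)) ∈ s ↔ (⟨a + 1, ha⟩ : Fin (2 * n)) ∈ s)) :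
    HasWeight (swapSet a ha s) (rotor a ha * basisOp s) := by
  intro b
  rw [exchangeSign_swapSet h, ← mul_assoc, majorana_mul_rotor, smul_mul_assoc, mul_assoc,
    majorana_mul_basisOp, mul_smul_comm, smul_smul, mul_assoc]

theorem rotor_commutator_basisOp (a : ℕ) (ha : a + 1 < 2 * n) (s : Finset (Fin (2 * n))) :
    rotor a ha * basisOp s - basisOp s * rotor a ha =
      coord (swapSet a ha s) (rotor a ha * basisOp s - basisOp s * rotor a ha) •
        basisOp (swapSet a ha s) := by
  have h1 := rotor_mul_basisOp a ha s
  rw [rotorSign_eq] at h1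
  split_ifs at h1 with h
  · rw [one_smul] at h1
    -- In the commuting case the coefficient is zero, so one formula covers both cases.
    rw [h1, sub_self, coord, mul_zero, Matrix.trace_zero, zero_smul]
  · have h2 : basisOp s * rotor a ha = -(rotor a ha * basisOp s) := by
      rw [h1, neg_one_smul, neg_neg]
    rw [h2, sub_neg_eq_add, ← two_smul ℂ]
    have h3 := (hasWeight_rotor_mul_basisOp h).eq_smul
    conv_lhs => rw [h3]
    rw [smul_smul]
    congr 1
    rw [coord, coord, mul_smul_comm, Matrix.trace_smul, smul_eq_mul]

theorem coord_rotor_commutator_swapSet (a : ℕ) (ha : a + 1 < 2 * n) (s t : Finset (Fin (2 * n))) :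
    coord s (rotor a ha * basisOp t - basisOp t * rotor a ha) =
      -coord t (rotor a ha * basisOp s - basisOp s * rotor a ha) := by
  simp only [coord, mul_sub, Matrix.trace_sub]
  rw [neg_sub, Matrix.trace_mul_comm (basisOp s) (rotor a ha * basisOp t), mul_assoc,
    Matrix.trace_mul_comm (rotor a ha), mul_assoc, Matrix.trace_mul_comm (basisOp s),
    mul_assoc, ← mul_assoc (basisOp t) (rotor a ha)]

/-! ### The Casimir operator -/

/-- The quadratic Casimir-type operator `∑_{|s| = κ} B_s ⊗ B_s`. -/
def casimir (n κ : ℕ) : Matrix (Bits n × Bits n) (Bits n × Bits n) ℂ :=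
  ∑ s ∈ (Finset.univ : Finset (Fin (2 * n))).powersetCard κ, basisOp s ⊗ₖ basisOp s

/-- The commutator splits into two sums, with the rotor acting on the left or on the right factor.
Reindexing by `swapSet` makes them opposite, because the adjoint action of the rotor is
antisymmetric for the trace form. -/
theorem commute_kroneckerSum_rotor_casimir (a : ℕ) (ha : a + 1 < 2 * n) (κ : ℕ) :
    Commute (kroneckerSum (rotor a ha)) (casimir n κ) := by
  rw [commute_iff_eq, ← sub_eq_zero, casimir, Finset.mul_sum, Finset.sum_mul,
    ← Finset.sum_sub_distrib]
  have key : ∀ s : Finset (Fin (2 * n)),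
      kroneckerSum (rotor a ha) * (basisOp s ⊗ₖ basisOp s) -
        (basisOp s ⊗ₖ basisOp s) * kroneckerSum (rotor a ha) =
      coord (swapSet a ha s) (rotor a ha * basisOp s - basisOp s * rotor a ha) •
        (basisOp (swapSet a ha s) ⊗ₖ basisOp s) +
      coord (swapSet a ha s) (rotor a ha * basisOp s - basisOp s * rotor a ha) •
        (basisOp s ⊗ₖ basisOp (swapSet a ha s)) := by
    intro s
    rw [← Matrix.smul_kronecker, ← Matrix.kronecker_smul, ← rotor_commutator_basisOp]
    simp only [kroneckerSum, kroneckerLeft_apply, kroneckerRight_apply, mul_add, add_mul,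
      ← Matrix.mul_kronecker_mul, one_mul, mul_one, sub_eq_add_neg, Matrix.add_kronecker,
      Matrix.kronecker_add, ← neg_one_smul ℂ (_ * _), Matrix.smul_kronecker, Matrix.kronecker_smul]
    simp only [neg_one_smul]
    abel
  rw [Finset.sum_congr rfl fun s _ => key s, Finset.sum_add_distrib, add_eq_zero_iff_eq_neg,
    ← Finset.sum_neg_distrib]
  refine Finset.sum_nbij' (swapSet a ha) (swapSet a ha) ?_ ?_ ?_ ?_ ?_
  · intro s hs
    simpa [Finset.mem_powersetCard, card_swapSet] using hs
  · intro s hs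
    simpa [Finset.mem_powersetCard, card_swapSet] using hs
  · intro s _; exact swapSet_swapSet a ha s
  · intro s _; exact swapSet_swapSet a ha s
  · intro s _
    rw [swapSet_swapSet, coord_rotor_commutator_swapSet, neg_smul]

/-! ### Invariants of the group -/

theorem group_induction {p : Matrix.unitaryGroup (Bits n) ℂ → Prop}
    (hexp : ∀ U : Matrix.unitaryGroup (Bits n) ℂ, ∀ A ∈ dla n, (U : Op n) = NormedSpace.exp A → p U)
    (hone : p 1) (hmul : ∀ U V, p U → p V → p (U * V)) (hinv : ∀ U, p U → p U⁻¹) (g : group n) :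
    p g := by
  obtain ⟨g, hg⟩ := g
  induction hg using Subgroup.closure_induction with
  | mem U h => obtain ⟨A, hA, h⟩ := h; exact hexp U A hA h
  | one => exact hone
  | mul U V _ _ hU hV => exact hmul U V hU hV
  | inv U _ hU => exact hinv U hU

theorem groupOp_mul (g h : group n) : groupOp (g * h) = groupOp g * groupOp h := rfl

theorem groupOp_inv (g : group n) : groupOp g⁻¹ = (groupOp g)ᴴ := rfl

theorem groupOp_conjTranspose_mul (g : group n) : (groupOp g)ᴴ * groupOp g = 1 := by
  rw [← groupOp_inv, ← groupOp_mul, inv_mul_cancel]; rfl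

theorem commute_groupOp_parity (g : group n) : Commute (groupOp g) (parity n) := by
  refine group_induction (p := fun U => Commute (U : Op n) (parity n)) ?_ ?_ ?_ ?_ g
  · intro U A hA hU
    rw [hU]
    exact Commute.exp_left (commute_of_mem_dla LinearMap.id (fun _ _ => rfl)
      commute_rotor_parity hA)
  · exact Commute.one_left _
  · intro U V hU hV
    exact hU.mul_left hV
  · intro U hU
    refine commute_of_inverse (u := (U : Op n)) ?_ ?_ hU
    · rw [← Submonoid.coe_mul, mul_inv_cancel]; rfl
    · rw [← Submonoid.coe_mul, inv_mul_cancel]; rfl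

theorem commute_groupOp_kronecker_casimir (g : group n) (κ : ℕ) :
    Commute (groupOp g ⊗ₖ groupOp g) (casimir n κ) := by
  let p : Matrix.unitaryGroup (Bits n) ℂ → Prop :=
    fun U => Commute ((U : Op n) ⊗ₖ (U : Op n)) (casimir n κ)
  suffices h : p (g : Matrix.unitaryGroup (Bits n) ℂ) from h
  refine group_induction ?_ ?_ ?_ ?_ g
  · intro U A hA hU
    simp only [p]
    rw [hU, ← exp_kroneckerSum]
    refine Commute.exp_left ?_
    let f : Op n →ₗ[ℝ] Matrix (Bits n × Bits n) (Bits n × Bits n) ℂ :=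
      { toFun := kroneckerSum
        map_add' := fun A B => by simp only [kroneckerSum, map_add]; abel
        map_smul' := fun r A => by
          ext i j
          simp [kroneckerSum, kroneckerLeft_apply, kroneckerRight_apply, Matrix.kroneckerMap_apply]
          ring }
    exact commute_of_mem_dla f kroneckerSum_lie
      (fun a ha => commute_kroneckerSum_rotor_casimir a ha κ) hA
  · simp only [p]
    rw [OneMemClass.coe_one, Matrix.one_kronecker_one]
    exact Commute.one_left _
  · intro U V hU hV
    simp only [p]
    rw [Submonoid.coe_mul, Matrix.mul_kronecker_mul]
    exact hU.mul_left hV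
  · intro U hU
    refine commute_of_inverse (u := (U : Op n) ⊗ₖ (U : Op n)) ?_ ?_ hU
    · rw [← Matrix.mul_kronecker_mul, ← Submonoid.coe_mul, mul_inv_cancel]
      exact Matrix.one_kronecker_one
    · rw [← Matrix.mul_kronecker_mul, ← Submonoid.coe_mul, inv_mul_cancel]
      exact Matrix.one_kronecker_one

theorem sum_coord_mul_coord_eq_trace (κ : ℕ) (M N : Op n) :
    ∑ s ∈ (Finset.univ : Finset (Fin (2 * n))).powersetCard κ, coord s M * coord s N =
      (casimir n κ * (M ⊗ₖ N)).trace := by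
  rw [casimir, Finset.sum_mul, Matrix.trace_sum]
  refine Finset.sum_congr rfl fun s _ => ?_
  rw [← Matrix.mul_kronecker_mul, Matrix.trace_kronecker, coord, coord]

/-- The sum is the trace of `casimir n κ` against `M ⊗ N`; `g ⊗ g` passes through the Casimir
operator and cancels by cyclicity. -/
theorem sum_coord_mul_coord_conj (κ : ℕ) (g : group n) (M N : Op n) :
    ∑ s ∈ (Finset.univ : Finset (Fin (2 * n))).powersetCard κ,
      coord s (groupOp g * M * (groupOp g)ᴴ) * coord s (groupOp g * N * (groupOp g)ᴴ) =
    ∑ s ∈ (Finset.univ : Finset (Fin (2 * n))).powersetCard κ, coord s M * coord s N := by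
  rw [sum_coord_mul_coord_eq_trace, sum_coord_mul_coord_eq_trace, Matrix.mul_kronecker_mul,
    Matrix.mul_kronecker_mul, ← mul_assoc, ← mul_assoc,
    ← (commute_groupOp_kronecker_casimir g κ).eq, Matrix.trace_mul_comm, ← mul_assoc, ← mul_assoc,
    ← Matrix.mul_kronecker_mul, groupOp_conjTranspose_mul, Matrix.one_kronecker_one, one_mul]

/-! ### Explicit group elements -/

theorem exists_groupOp_eq_rotation (a : ℕ) (ha : a + 1 < 2 * n) (t : ℝ) :
    ∃ g : group n, groupOp g = (Real.cos t : ℂ) • (1 : Op n) + (Real.sin t : ℂ) • rotor a ha := by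
  have h1 : (Real.cos t : ℂ) * Real.cos t + Real.sin t * Real.sin t = 1 := by
    rw [← Complex.ofReal_mul, ← Complex.ofReal_mul, ← Complex.ofReal_add, ← sq, ← sq,
      Real.cos_sq_add_sin_sq, Complex.ofReal_one]
  have hu : (Real.cos t : ℂ) • (1 : Op n) + (Real.sin t : ℂ) • rotor a ha ∈
      Matrix.unitaryGroup (Bits n) ℂ := by
    rw [Matrix.mem_unitaryGroup_iff, Matrix.star_eq_conjTranspose, Matrix.conjTranspose_add,
      Matrix.conjTranspose_smul, Matrix.conjTranspose_smul, rotor_conjTranspose,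
      Matrix.conjTranspose_one, Complex.star_def, Complex.conj_ofReal, Complex.conj_ofReal,
      add_mul, mul_add, mul_add]
    simp only [smul_mul_smul_comm, one_mul, mul_one, mul_neg, rotor_mul_self, neg_neg, smul_neg]
    rw [mul_comm (Real.sin t : ℂ) (Real.cos t : ℂ), add_assoc, neg_add_cancel_left, ← add_smul, h1,
      one_smul]
  refine ⟨⟨⟨_, hu⟩, Subgroup.subset_closure ⟨t • rotor a ha, ?_, ?_⟩⟩, rfl⟩
  · refine (dla n).smul_mem t (LieSubalgebra.subset_lieSpan ?_)
    exact exists_rotor_eq_I_smul_toOp a ha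
  · exact (exp_real_smul_of_mul_self_eq_neg_one (rotor_mul_self a ha) t).symm

theorem exists_groupOp_eq_rotor (a : ℕ) (ha : a + 1 < 2 * n) :
    ∃ g : group n, groupOp g = rotor a ha := by
  obtain ⟨g, hg⟩ := exists_groupOp_eq_rotation a ha (Real.pi / 2)
  exact ⟨g, by simpa using hg⟩

theorem exists_conj_basisOp_eq_rotorSign_smul (a : ℕ) (ha : a + 1 < 2 * n) :
    ∃ g : group n, ∀ s, (groupOp g)ᴴ * basisOp s * groupOp g = rotorSign a ha s • basisOp s := by
  obtain ⟨g, hg⟩ := exists_groupOp_eq_rotor a ha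
  refine ⟨g, fun s => ?_⟩
  rw [hg, rotor_conjTranspose, neg_mul, rotor_mul_basisOp, neg_mul, smul_mul_assoc, mul_assoc,
    rotor_mul_self, mul_neg_one, smul_neg, neg_neg]

/-- If the rotor `R` anticommutes with `B = basisOp s`, then `g† B g = (g†)² B`. The angle `π/4` is
chosen so that `(g†)² = -R`, and `R B` is a multiple of the swapped basis operator. -/
theorem exists_conj_basisOp_eq_smul_swapSet (a : ℕ) (ha : a + 1 < 2 * n) :
    ∃ g : group n, ∀ s, ∃ ε : ℂ, ε * ε = 1 ∧
      (groupOp g)ᴴ * basisOp s * groupOp g = ε • basisOp (swapSet a ha s) := by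
  obtain ⟨g, hg⟩ := exists_groupOp_eq_rotation a ha (Real.pi / 4)
  refine ⟨g, fun s => ?_⟩
  have h1 := rotor_mul_basisOp a ha s
  rw [rotorSign_eq] at h1
  split_ifs at h1 with h
  · refine ⟨1, one_mul 1, ?_⟩
    have h2 : groupOp g * basisOp s = basisOp s * groupOp g := by
      rw [hg, add_mul, mul_add, smul_mul_assoc, smul_mul_assoc, h1, mul_smul_comm, mul_smul_comm]
      simp
    rw [mul_assoc, ← h2, ← mul_assoc, groupOp_conjTranspose_mul, one_mul, one_smul,
      swapSet_eq_self h]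
  · rw [neg_one_smul] at h1
    have h2 := (hasWeight_rotor_mul_basisOp h).eq_smul
    set c := coord (swapSet a ha s) (rotor a ha * basisOp s)
    have hc : c * c = 1 := by
      have h3 : (rotor a ha * basisOp s) * (rotor a ha * basisOp s) = basisOp s * basisOp s := by
        nth_rewrite 1 [h1]
        rw [neg_mul, mul_assoc, ← mul_assoc (rotor a ha), rotor_mul_self, neg_one_mul, mul_neg,
          neg_neg]
      rw [h2, smul_mul_smul_comm] at h3
      simpa [Matrix.trace_smul, trace_basisOp_mul_self] using congrArg Matrix.trace h3
    refine ⟨-c, by rw [neg_mul_neg, hc], ?_⟩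
    have h4 : basisOp s * groupOp g = (groupOp g)ᴴ * basisOp s := by
      rw [hg, Matrix.conjTranspose_add, Matrix.conjTranspose_smul, Matrix.conjTranspose_smul,
        rotor_conjTranspose, Matrix.conjTranspose_one, Complex.star_def, Complex.conj_ofReal,
        Complex.conj_ofReal, add_mul, mul_add, smul_mul_assoc, smul_mul_assoc, neg_mul, h1,
        mul_smul_comm, mul_smul_comm, neg_neg]
      simp
    have hs : (Real.cos (Real.pi / 4) : ℂ) * Real.cos (Real.pi / 4) = 1 / 2 := by
      rw [← Complex.ofReal_mul, Real.cos_pi_div_four, div_mul_div_comm,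
        Real.mul_self_sqrt (by norm_num)]
      norm_num
    have h5 : (groupOp g)ᴴ * (groupOp g)ᴴ = -rotor a ha := by
      rw [hg, Matrix.conjTranspose_add, Matrix.conjTranspose_smul, Matrix.conjTranspose_smul,
        rotor_conjTranspose, Matrix.conjTranspose_one, Complex.star_def, Complex.conj_ofReal,
        Complex.conj_ofReal, Real.sin_pi_div_four, ← Real.cos_pi_div_four, ← smul_add,
        smul_mul_smul_comm, hs, add_mul, mul_add, mul_add, neg_mul_neg, rotor_mul_self]
      simp only [one_mul, mul_one]
      module
    rw [mul_assoc, h4, ← mul_assoc, h5, neg_mul, h2, neg_smul]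

/-! ### Haar moments of the orbit coordinates -/

section Moments

theorem continuous_groupOp : Continuous (groupOp : group n → Op n) :=
  continuous_subtype_val.comp continuous_subtype_val

/-- Unitary matrices have entries in the unit disc, so they lie in a compact set on which `F` is
bounded. Compactness of `G` is not needed. -/
theorem exists_bound_of_mem_unitaryGroup {F : Op n → ℂ} (hF : Continuous F) :
    ∃ C, ∀ U ∈ Matrix.unitaryGroup (Bits n) ℂ, ‖F U‖ ≤ C := by
  have hK : IsCompact (Set.univ.pi fun _ : Bits n => Set.univ.pi fun _ : Bits n =>
      Metric.closedBall (0 : ℂ) 1) :=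
    isCompact_univ_pi fun _ => isCompact_univ_pi fun _ => isCompact_closedBall _ _
  obtain ⟨C, hC⟩ := hK.exists_bound_of_continuousOn (f := F) hF.continuousOn
  refine ⟨C, fun U hU => hC U fun i _ j _ => ?_⟩
  rw [mem_closedBall_zero_iff]
  exact entry_norm_bound_of_unitary hU i j

theorem integrable_comp_of_mem_unitaryGroup {Θ : Type*} [MeasurableSpace Θ] [TopologicalSpace Θ]
    [OpensMeasurableSpace Θ] {μ : Measure Θ} [IsFiniteMeasure μ] {U : Θ → Op n}
    (hU : Continuous U) (hU' : ∀ θ, U θ ∈ Matrix.unitaryGroup (Bits n) ℂ) {F : Op n → ℂ}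
    (hF : Continuous F) : Integrable (fun θ => F (U θ)) μ := by
  obtain ⟨C, hC⟩ := exists_bound_of_mem_unitaryGroup hF
  exact Integrable.of_bound (hF.comp hU).aestronglyMeasurable C
    (Filter.Eventually.of_forall fun θ => hC _ (hU' θ))

theorem groupOp_mem_unitaryGroup (g : group n) : groupOp g ∈ Matrix.unitaryGroup (Bits n) ℂ :=
  g.1.2

theorem integrable_comp_groupOp (ν : Measure (group n)) [IsFiniteMeasure ν] {F : Op n → ℂ}
    (hF : Continuous F) : Integrable (fun g => F (groupOp g)) ν :=
  integrable_comp_of_mem_unitaryGroup continuous_groupOp groupOp_mem_unitaryGroup hF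

/-- The coefficients of `g M g†`. -/
def orbitCoord (M : Op n) (s : Finset (Fin (2 * n))) (g : group n) : ℂ :=
  coord s (groupOp g * M * (groupOp g)ᴴ)

theorem continuous_coord_conj (M : Op n) (s : Finset (Fin (2 * n))) :
    Continuous fun U : Op n => coord s (U * M * Uᴴ) := by
  unfold coord
  fun_prop

theorem orbitCoord_mul_left {s t : Finset (Fin (2 * n))} {h : group n} {ε : ℂ}
    (hε : (groupOp h)ᴴ * basisOp s * groupOp h = ε • basisOp t) (M : Op n) (g : group n) :
    orbitCoord M s (h * g) = ε * orbitCoord M t g := by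
  have h1 : basisOp s * (groupOp h * groupOp g * M * ((groupOp g)ᴴ * (groupOp h)ᴴ)) =
      (basisOp s * groupOp h * (groupOp g * M * (groupOp g)ᴴ)) * (groupOp h)ᴴ := by
    simp only [mul_assoc]
  rw [orbitCoord, orbitCoord, groupOp_mul, coord, coord, Matrix.conjTranspose_mul, h1,
    Matrix.trace_mul_comm, ← mul_assoc, ← mul_assoc (groupOp h)ᴴ, hε, smul_mul_assoc,
    Matrix.trace_smul, smul_eq_mul]

theorem integral_orbitCoord_eq_zero_of_rotorSign (ν : Measure (group n)) [ν.IsMulLeftInvariant]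
    {a : ℕ} {ha : a + 1 < 2 * n} {s : Finset (Fin (2 * n))} (hs : rotorSign a ha s = -1)
    (M : Op n) : ∫ g, orbitCoord M s g ∂ν = 0 := by
  obtain ⟨h, hh⟩ := exists_conj_basisOp_eq_rotorSign_smul a ha
  have key := integral_mul_left_eq_self (μ := ν) (orbitCoord M s) h
  simp only [orbitCoord_mul_left (hh s), hs, neg_one_mul, integral_neg] at key
  exact self_eq_neg.mp key.symm

theorem integral_orbitCoord_mul_eq_zero_of_rotorSign (ν : Measure (group n))
    [ν.IsMulLeftInvariant] {a : ℕ} {ha : a + 1 < 2 * n} {s t : Finset (Fin (2 * n))}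
    (hs : rotorSign a ha s * rotorSign a ha t = -1) (M N : Op n) :
    ∫ g, orbitCoord M s g * orbitCoord N t g ∂ν = 0 := by
  obtain ⟨h, hh⟩ := exists_conj_basisOp_eq_rotorSign_smul a ha
  have key := integral_mul_left_eq_self (μ := ν) (fun g => orbitCoord M s g * orbitCoord N t g) h
  have e : ∀ g, rotorSign a ha s * orbitCoord M s g * (rotorSign a ha t * orbitCoord N t g) =
      -(orbitCoord M s g * orbitCoord N t g) :=
    fun g => by linear_combination (orbitCoord M s g * orbitCoord N t g) * hs
  simp only [orbitCoord_mul_left (hh s), orbitCoord_mul_left (hh t), e, integral_neg] at key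
  exact self_eq_neg.mp key.symm

theorem forall_or_forall_not_of_iff_succ {m : ℕ} {p : Fin m → Prop}
    (h : ∀ (a : ℕ) (ha : a + 1 < m), p ⟨a, by omega⟩ ↔ p ⟨a + 1, ha⟩) :
    (∀ b, p b) ∨ ∀ b, ¬ p b := by
  rcases m with _ | m
  · exact Or.inl fun b => b.elim0
  · have key : ∀ (b : ℕ) (hb : b < m + 1), p ⟨b, hb⟩ ↔ p 0 := by
      intro b
      induction b with
      | zero => exact fun _ => Iff.rfl
      | succ b ih => exact fun hb => (h b hb).symm.trans (ih (by omega))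
    by_cases h0 : p 0
    · exact Or.inl fun b => (key b b.2).2 h0
    · exact Or.inr fun b hb => h0 ((key b b.2).1 hb)

theorem integral_orbitCoord_eq_zero (ν : Measure (group n)) [ν.IsMulLeftInvariant]
    {s : Finset (Fin (2 * n))} (h0 : s ≠ ∅) (h1 : s ≠ Finset.univ) (M : Op n) :
    ∫ g, orbitCoord M s g ∂ν = 0 := by
  by_contra hne
  rcases forall_or_forall_not_of_iff_succ (p := (· ∈ s)) (fun a ha => by
    by_contra hc
    exact hne (integral_orbitCoord_eq_zero_of_rotorSign ν
      (by rw [rotorSign_eq a ha, if_neg hc]) M)) with h | h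
  · exact h1 (Finset.eq_univ_iff_forall.2 h)
  · exact h0 (Finset.eq_empty_iff_forall_notMem.2 h)

theorem integral_orbitCoord_mul_eq_zero (ν : Measure (group n)) [ν.IsMulLeftInvariant]
    {s t : Finset (Fin (2 * n))} (h0 : t ≠ s) (h1 : t ≠ sᶜ) (M N : Op n) :
    ∫ g, orbitCoord M s g * orbitCoord N t g ∂ν = 0 := by
  by_contra hne
  -- If the symmetric difference of `s` and `t` separates no neighbours, it is empty or everything,
  -- that is `t = s` or `t = sᶜ`.
  rcases forall_or_forall_not_of_iff_succ (p := fun b => b ∈ s ↔ b ∈ t) (fun a ha => by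
    by_contra hc
    refine hne (integral_orbitCoord_mul_eq_zero_of_rotorSign ν (a := a) (ha := ha) ?_ M N)
    rw [rotorSign_eq, rotorSign_eq]
    split_ifs
    · exact absurd hc (by tauto)
    · norm_num
    · norm_num
    · exact absurd hc (by tauto)) with h | h
  · exact h0 (Finset.ext fun b => (h b).symm)
  · refine h1 (Finset.ext fun b => ?_)
    have := h b
    rw [Finset.mem_compl]
    tauto

/-- Adjacent transpositions generate the symmetric group, and a bijection from `s` to `t` extends to
a permutation. -/
theorem eq_of_card_eq_of_swapSet_invariant {R : Type*} {F : Finset (Fin (2 * n)) → R}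
    (hF : ∀ a ha s, F (swapSet a ha s) = F s) {s t : Finset (Fin (2 * n))}
    (hst : s.card = t.card) : F s = F t := by
  -- A general `m` replaces `2 * n` so that it can be split into `0` and `m + 1`, the form in which
  -- generation by adjacent transpositions is available.
  have key : ∀ (m : ℕ) (G : Finset (Fin m) → R),
      (∀ (a : ℕ) (ha : a + 1 < m) (s : Finset (Fin m)),
        G (s.map (Equiv.swap ⟨a, by omega⟩ ⟨a + 1, ha⟩ : Equiv.Perm (Fin m)).toEmbedding) = G s) →
      ∀ (σ : Equiv.Perm (Fin m)) (s : Finset (Fin m)), G (s.map σ.toEmbedding) = G s := by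
    intro m G hG σ
    rcases m with _ | m
    · intro s
      congr 1
      exact Subsingleton.elim _ _
    · have hσ : σ ∈ Submonoid.closure
          (Set.range fun i : Fin m => Equiv.swap i.castSucc i.succ) := by
        rw [Equiv.Perm.mclosure_swap_castSucc_succ]; trivial
      induction hσ using Submonoid.closure_induction with
      | mem σ h =>
        obtain ⟨i, rfl⟩ := h
        exact fun s => hG i (by omega) s
      | one => intro s; congr 1; exact Finset.map_refl
      | mul σ τ _ _ hσ hτ =>
        intro s
        rw [← hτ s, ← hσ (s.map τ.toEmbedding), Finset.map_map]
        rfl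
  have e : {x // x ∈ s} ≃ {x // x ∈ t} := Finset.equivOfCardEq hst
  have ht : s.map (e.extendSubtype).toEmbedding = t := by
    refine Finset.eq_of_subset_of_card_le (fun b hb => ?_) (by rw [Finset.card_map, hst])
    obtain ⟨c, hc, rfl⟩ := Finset.mem_map.1 hb
    exact e.extendSubtype_mem c hc
  rw [← ht]
  exact (key (2 * n) F hF _ s).symm

theorem integral_orbitCoord_mul_swapSet (ν : Measure (group n)) [ν.IsMulLeftInvariant]
    (M N : Op n) (a : ℕ) (ha : a + 1 < 2 * n) (s : Finset (Fin (2 * n))) :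
    ∫ g, orbitCoord M (swapSet a ha s) g * orbitCoord N (swapSet a ha s) g ∂ν =
      ∫ g, orbitCoord M s g * orbitCoord N s g ∂ν := by
  obtain ⟨h, hh⟩ := exists_conj_basisOp_eq_smul_swapSet a ha
  obtain ⟨ε, hε, hs⟩ := hh s
  rw [← integral_mul_left_eq_self (μ := ν) (fun g => orbitCoord M s g * orbitCoord N s g) h]
  simp only [orbitCoord_mul_left hs, mul_mul_mul_comm ε, hε, one_mul]

theorem integrable_orbitCoord (ν : Measure (group n)) [IsFiniteMeasure ν] (M : Op n)
    (s : Finset (Fin (2 * n))) : Integrable (orbitCoord M s) ν :=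
  integrable_comp_groupOp ν (continuous_coord_conj M s)

theorem integrable_orbitCoord_mul (ν : Measure (group n)) [IsFiniteMeasure ν] (M N : Op n)
    (s t : Finset (Fin (2 * n))) :
    Integrable (fun g => orbitCoord M s g * orbitCoord N t g) ν :=
  integrable_comp_groupOp ν ((continuous_coord_conj M s).mul (continuous_coord_conj N t))

/-- The sum over sets of one size is constant on the orbit and its terms have equal means. Keeping
`M` and `N` distinct allows `N = M * P` later. -/
theorem choose_card_mul_integral_orbitCoord_mul (ν : Measure (group n)) [ν.IsMulLeftInvariant]
    [IsProbabilityMeasure ν] (M N : Op n) (s : Finset (Fin (2 * n))) :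
    ((2 * n).choose s.card : ℂ) * ∫ g, orbitCoord M s g * orbitCoord N s g ∂ν =
      ∑ t ∈ (Finset.univ : Finset (Fin (2 * n))).powersetCard s.card, coord t M * coord t N := by
  have h1 : ∑ t ∈ (Finset.univ : Finset (Fin (2 * n))).powersetCard s.card,
      ∫ g, orbitCoord M t g * orbitCoord N t g ∂ν =
      ∑ t ∈ (Finset.univ : Finset (Fin (2 * n))).powersetCard s.card, coord t M * coord t N := by
    rw [← integral_finsetSum _ fun t _ => integrable_orbitCoord_mul ν M N t t]
    simp only [orbitCoord, sum_coord_mul_coord_conj]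
    simp
  have h2 : ∀ t ∈ (Finset.univ : Finset (Fin (2 * n))).powersetCard s.card,
      ∫ g, orbitCoord M t g * orbitCoord N t g ∂ν = ∫ g, orbitCoord M s g * orbitCoord N s g ∂ν :=
    fun t ht => eq_of_card_eq_of_swapSet_invariant
      (F := fun t => ∫ g, orbitCoord M t g * orbitCoord N t g ∂ν)
      (integral_orbitCoord_mul_swapSet ν M N) (Finset.mem_powersetCard.1 ht).2
  rw [← h1, Finset.sum_congr rfl h2]
  simp

theorem coord_mul_parity (s : Finset (Fin (2 * n))) (M : Op n) :
    coord s (M * parity n) = parityPhase s * coord sᶜ M := by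
  rw [coord, ← mul_assoc, Matrix.trace_mul_comm, ← mul_assoc, parity_mul_basisOp,
    smul_mul_assoc, Matrix.trace_smul, smul_eq_mul, coord]

theorem orbitCoord_mul_parity (s : Finset (Fin (2 * n))) (M : Op n) (g : group n) :
    orbitCoord (M * parity n) s g = parityPhase s * orbitCoord M sᶜ g := by
  have h : parity n * (groupOp g)ᴴ = (groupOp g)ᴴ * parity n :=
    (commute_groupOp_parity g⁻¹).eq.symm
  rw [orbitCoord, orbitCoord, ← coord_mul_parity, ← mul_assoc, mul_assoc _ (parity n), h,
    ← mul_assoc]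

/-- The sum `∑_{|s| = κ} m_s²` of the coefficients of `M`. -/
def coordSq (κ : ℕ) (M : Op n) : ℂ :=
  ∑ s ∈ (Finset.univ : Finset (Fin (2 * n))).powersetCard κ, coord s M * coord s M

/-- The sum `∑_{|s| = κ} η_s m_s m_{sᶜ}` of the coefficients of `M`. -/
def coordCross (κ : ℕ) (M : Op n) : ℂ :=
  ∑ s ∈ (Finset.univ : Finset (Fin (2 * n))).powersetCard κ,
    parityPhase s * (coord s M * coord sᶜ M)

theorem choose_ne_zero (s : Finset (Fin (2 * n))) : ((2 * n).choose s.card : ℂ) ≠ 0 := by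
  have h : s.card ≤ 2 * n := by simpa using Finset.card_le_univ s
  exact_mod_cast (Nat.choose_pos h).ne'

theorem integral_orbitCoord_mul_self (ν : Measure (group n)) [ν.IsMulLeftInvariant]
    [IsProbabilityMeasure ν] (M : Op n) (s : Finset (Fin (2 * n))) :
    ∫ g, orbitCoord M s g * orbitCoord M s g ∂ν =
      coordSq s.card M / ((2 * n).choose s.card : ℂ) := by
  rw [eq_div_iff (choose_ne_zero s), mul_comm, choose_card_mul_integral_orbitCoord_mul, coordSq]

/-- Right multiplication by `P` turns the coordinate at `s` into `η_s` times the one at `sᶜ`; the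
prefactor on the right is `η_s⁻¹ = (-1)^|s| η_s`. -/
theorem integral_orbitCoord_mul_compl (ν : Measure (group n)) [ν.IsMulLeftInvariant]
    [IsProbabilityMeasure ν] (M : Op n) (s : Finset (Fin (2 * n))) :
    ∫ g, orbitCoord M s g * orbitCoord M sᶜ g ∂ν =
      (-1) ^ s.card * parityPhase s * (coordCross s.card M / ((2 * n).choose s.card : ℂ)) := by
  have h := choose_card_mul_integral_orbitCoord_mul ν M (M * parity n) s
  simp only [orbitCoord_mul_parity, coord_mul_parity, mul_left_comm _ (parityPhase _),
    integral_const_mul] at h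
  change _ = coordCross s.card M at h
  rw [← h, ← parityPhase_mul_self, mul_left_comm (parityPhase s) (Nat.cast _),
    mul_div_cancel_left₀]
  · have h2 : parityPhase s * parityPhase s * (parityPhase s * parityPhase s) = 1 := by
      rw [parityPhase_mul_self, neg_one_pow_mul_self]
    linear_combination (-∫ g, orbitCoord M s g * orbitCoord M sᶜ g ∂ν) * h2
  · exact choose_ne_zero s

theorem trace_conj_mul_eq_sum (ρ O : Op n) (g : group n) :
    (groupOp g * ρ * (groupOp g)ᴴ * O).trace = ∑ s, orbitCoord ρ s g * coord s O :=
  trace_mul_eq_sum_coord _ _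

theorem basisOp_empty : basisOp (∅ : Finset (Fin (2 * n))) = basisCoeff n 0 • (1 : Op n) := by
  simp [basisOp_eq, majoranaProd]

theorem orbitCoord_empty (M : Op n) (g : group n) : orbitCoord M ∅ g = coord ∅ M := by
  rw [orbitCoord, coord, coord, basisOp_empty, smul_mul_assoc, smul_mul_assoc, one_mul, one_mul,
    Matrix.trace_smul, Matrix.trace_smul, Matrix.trace_mul_comm, ← mul_assoc,
    groupOp_conjTranspose_mul, one_mul]

theorem parityPhase_ne_zero (s : Finset (Fin (2 * n))) : parityPhase s ≠ 0 := by
  intro h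
  have := parityPhase_mul_self s
  rw [h, mul_zero] at this
  exact pow_ne_zero _ (neg_ne_zero.2 one_ne_zero) this.symm

theorem orbitCoord_univ (M : Op n) (g : group n) :
    orbitCoord M Finset.univ g = coord Finset.univ M := by
  have h1 := orbitCoord_mul_parity ∅ M g
  have h2 := coord_mul_parity ∅ M
  rw [orbitCoord_empty, h2, Finset.compl_empty] at h1
  exact (mul_left_cancel₀ (parityPhase_ne_zero _) h1).symm

theorem integral_trace_conj_mul (hn : 1 ≤ n) (ν : Measure (group n)) [ν.IsMulLeftInvariant]
    [IsProbabilityMeasure ν] (ρ O : Op n) :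
    ∫ g, (groupOp g * ρ * (groupOp g)ᴴ * O).trace ∂ν =
      coord ∅ ρ * coord ∅ O + coord Finset.univ ρ * coord Finset.univ O := by
  simp only [trace_conj_mul_eq_sum]
  rw [integral_finsetSum _ fun s _ => (integrable_orbitCoord ν ρ s).mul_const _]
  have hne : (∅ : Finset (Fin (2 * n))) ≠ Finset.univ := by
    intro h
    have := congrArg Finset.card h
    simp at this
    omega
  rw [← Finset.sum_subset (Finset.subset_univ {∅, Finset.univ}), Finset.sum_pair hne]
  · simp [orbitCoord_empty, orbitCoord_univ]
  · intro s _ hs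
    simp only [Finset.mem_insert, Finset.mem_singleton, not_or] at hs
    rw [integral_mul_const, integral_orbitCoord_eq_zero ν hs.1 hs.2, zero_mul]

theorem integral_trace_conj_mul_sq (hn : 1 ≤ n) (ν : Measure (group n)) [ν.IsMulLeftInvariant]
    [IsProbabilityMeasure ν] (ρ O : Op n) :
    ∫ g, (groupOp g * ρ * (groupOp g)ᴴ * O).trace ^ 2 ∂ν =
      ∑ κ ∈ Finset.range (2 * n + 1),
        (coordSq κ ρ * coordSq κ O + (-1) ^ κ * (coordCross κ ρ * coordCross κ O)) /
          ((2 * n).choose κ : ℂ) := by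
  simp only [trace_conj_mul_eq_sum, sq, Finset.sum_mul_sum,
    mul_mul_mul_comm (orbitCoord ρ _ _) (coord _ O)]
  rw [integral_finsetSum _ fun s _ => integrable_finsetSum _ fun t _ =>
    (integrable_orbitCoord_mul ν ρ ρ s t).mul_const _]
  have h1 : ∀ s : Finset (Fin (2 * n)),
      ∫ g, ∑ t, orbitCoord ρ s g * orbitCoord ρ t g * (coord s O * coord t O) ∂ν =
        coordSq s.card ρ / ((2 * n).choose s.card : ℂ) * (coord s O * coord s O) +
        (-1) ^ s.card * (coordCross s.card ρ / ((2 * n).choose s.card : ℂ)) *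
          (parityPhase s * (coord s O * coord sᶜ O)) := by
    intro s
    -- Index `0` exists since `n ≥ 1`, and it lies in exactly one of the two sets.
    have hne : s ≠ sᶜ := by
      intro h
      have h2 : (⟨0, by omega⟩ : Fin (2 * n)) ∈ s ↔ (⟨0, by omega⟩ : Fin (2 * n)) ∈ sᶜ := by
        rw [← h]
      rw [Finset.mem_compl] at h2
      tauto
    rw [integral_finsetSum _ fun t _ => (integrable_orbitCoord_mul ν ρ ρ s t).mul_const _,
      ← Finset.sum_subset (Finset.subset_univ {s, sᶜ}), Finset.sum_pair hne]
    · rw [integral_mul_const, integral_mul_const, integral_orbitCoord_mul_self,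
        integral_orbitCoord_mul_compl]
      ring
    · intro t _ ht
      simp only [Finset.mem_insert, Finset.mem_singleton, not_or] at ht
      rw [integral_mul_const, integral_orbitCoord_mul_eq_zero ν ht.1 ht.2, zero_mul]
  rw [Finset.sum_congr rfl fun s _ => h1 s, ← Finset.powerset_univ, Finset.sum_powerset,
    Finset.card_univ, Fintype.card_fin]
  refine Finset.sum_congr rfl fun κ _ => ?_
  have h2 : ∀ s ∈ (Finset.univ : Finset (Fin (2 * n))).powersetCard κ,
      coordSq s.card ρ / ((2 * n).choose s.card : ℂ) * (coord s O * coord s O) +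
        (-1) ^ s.card * (coordCross s.card ρ / ((2 * n).choose s.card : ℂ)) *
          (parityPhase s * (coord s O * coord sᶜ O)) =
      coordSq κ ρ / ((2 * n).choose κ : ℂ) * (coord s O * coord s O) +
        (-1) ^ κ * (coordCross κ ρ / ((2 * n).choose κ : ℂ)) *
          (parityPhase s * (coord s O * coord sᶜ O)) := by
    intro s hs
    rw [(Finset.mem_powersetCard.1 hs).2]
  rw [Finset.sum_congr rfl h2, Finset.sum_add_distrib, ← Finset.mul_sum, ← Finset.mul_sum,
    ← coordSq, ← coordCross]
  ring

end Moments

/-! ### Purities, coherences and module dimensions -/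

section Components

theorem coord_component (κ : ℕ) (M : Op n) (s : Finset (Fin (2 * n))) :
    coord s (component κ M) = if s.card = κ then coord s M else 0 := by
  simp [coord, component, Finset.mul_sum, Matrix.trace_sum, trace_basisOp_mul_basisOp]

theorem star_coord {M : Op n} (hM : M.IsHermitian) (s : Finset (Fin (2 * n))) :
    star (coord s M) = coord s M := by
  rw [← coord_conjTranspose, hM.eq]

theorem component_conjTranspose (κ : ℕ) {M : Op n} (hM : M.IsHermitian) :
    (component κ M)ᴴ = component κ M := by
  rw [component, Matrix.conjTranspose_sum]
  refine Finset.sum_congr rfl fun s _ => ?_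
  rw [Matrix.conjTranspose_smul, basisOp_conjTranspose]
  congr 1
  exact star_coord hM s

theorem form_one_component (κ : ℕ) {M : Op n} (hM : M.IsHermitian) (N : Op n) :
    form 1 (component κ M) N =
      ∑ s ∈ (Finset.univ : Finset (Fin (2 * n))).powersetCard κ, coord s M * coord s N := by
  rw [form, component_conjTranspose κ hM, one_mul, trace_mul_eq_sum_coord,
    ← Finset.sum_subset (Finset.subset_univ (Finset.univ.powersetCard κ))]
  · refine Finset.sum_congr rfl fun s hs => ?_
    rw [coord_component, if_pos (Finset.mem_powersetCard.1 hs).2]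
  · intro s _ hs
    rw [coord_component, if_neg (by simpa [Finset.mem_powersetCard] using hs), zero_mul]

theorem form_parity_component (κ : ℕ) {M : Op n} (hM : M.IsHermitian) (N : Op n) :
    form (parity n) (component κ M) N =
      ∑ s ∈ (Finset.univ : Finset (Fin (2 * n))).powersetCard κ,
        parityPhase s * (coord s M * coord sᶜ N) := by
  have h : form (parity n) (component κ M) N = form 1 (component κ M) (N * parity n) := by
    rw [form, form, one_mul, mul_assoc, Matrix.trace_mul_comm, mul_assoc]
  rw [h, form_one_component κ hM]
  refine Finset.sum_congr rfl fun s _ => ?_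
  rw [coord_mul_parity]
  ring

theorem purity_eq_coordSq (κ : ℕ) {M : Op n} (hM : M.IsHermitian) :
    purity κ M = coordSq κ M := by
  rw [purity, form_one_component κ hM, coordSq]
  refine Finset.sum_congr rfl fun s hs => ?_
  rw [coord_component, if_pos (Finset.mem_powersetCard.1 hs).2]

theorem coherence_eq_coordCross (κ : ℕ) {M : Op n} (hM : M.IsHermitian) :
    coherence κ M = Complex.I ^ (κ % 2) * coordCross κ M := by
  rw [coherence, form_parity_component κ hM, coordCross]
  congr 1
  refine Finset.sum_congr rfl fun s hs => ?_
  rw [coord_component, if_pos]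
  rw [Finset.card_compl, Fintype.card_fin, (Finset.mem_powersetCard.1 hs).2]

theorem I_pow_mod_two_mul_self (κ : ℕ) :
    Complex.I ^ (κ % 2) * Complex.I ^ (κ % 2) = (-1) ^ κ := by
  rw [neg_one_pow_eq_pow_mod_two, ← mul_pow, Complex.I_mul_I]

/-- The two prefactors `i^(κ mod 2)` multiply to the sign `(-1)^κ` of the second moment. -/
theorem coherence_mul_coherence (κ : ℕ) {M N : Op n} (hM : M.IsHermitian) (hN : N.IsHermitian) :
    coherence κ M * coherence κ N = (-1) ^ κ * (coordCross κ M * coordCross κ N) := by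
  rw [coherence_eq_coordCross κ hM, coherence_eq_coordCross κ hN, ← I_pow_mod_two_mul_self]
  ring

/-- The `P` part pairs size `κ` with size `2n - κ`, which differs from `κ` at both endpoints. -/
theorem form_one_add_parity_component (hn : 1 ≤ n) {κ : ℕ} (hκ : κ ∈ ({0, 2 * n} : Finset ℕ))
    {M : Op n} (hM : M.IsHermitian) (N : Op n) :
    form (1 + parity n) (component κ M) (component κ N) =
      ∑ s ∈ (Finset.univ : Finset (Fin (2 * n))).powersetCard κ, coord s M * coord s N := by
  have h : form (1 + parity n) (component κ M) (component κ N) =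
      form 1 (component κ M) (component κ N) +
        form (parity n) (component κ M) (component κ N) := by
    simp only [form, add_mul, Matrix.trace_add]
  rw [h, form_one_component κ hM, form_parity_component κ hM, add_eq_left.2]
  · refine Finset.sum_congr rfl fun s hs => ?_
    rw [coord_component, if_pos (Finset.mem_powersetCard.1 hs).2]
  · refine Finset.sum_eq_zero fun s hs => ?_
    rw [coord_component, if_neg, mul_zero, mul_zero]
    rw [Finset.card_compl, Fintype.card_fin, (Finset.mem_powersetCard.1 hs).2]
    simp only [Finset.mem_insert, Finset.mem_singleton] at hκ
    omega

theorem powersetCard_univ_full :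
    (Finset.univ : Finset (Fin (2 * n))).powersetCard (2 * n) = {Finset.univ} := by
  have h := Finset.powersetCard_self (Finset.univ : Finset (Fin (2 * n)))
  rwa [Finset.card_univ, Fintype.card_fin] at h

theorem finrank_majoranaModule (n κ : ℕ) :
    Module.finrank ℂ (majoranaModule n κ) = (2 * n).choose κ := by
  have hli : LinearIndependent ℂ (majoranaProd : Finset (Fin (2 * n)) → Op n) := by
    rw [Fintype.linearIndependent_iff]
    intro c hc s
    have h := Fintype.linearIndependent_iff.1 linearIndependent_basisOp
      (fun s : Finset (Fin (2 * n)) => c s * (basisCoeff n s.card)⁻¹) (by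
        rw [← hc]
        refine Finset.sum_congr rfl fun s _ => ?_
        rw [basisOp_eq, smul_smul, mul_assoc, inv_mul_cancel₀ (basisCoeff_ne_zero _ _), mul_one]) s
    exact (mul_eq_zero.1 h).resolve_right (inv_ne_zero (basisCoeff_ne_zero _ _))
  have hset : {B : Op n | ∃ s : Finset (Fin (2 * n)), s.card = κ ∧ B = majoranaProd s} =
      Set.range fun s : {s : Finset (Fin (2 * n)) // s.card = κ} => majoranaProd s.1 := by
    ext B
    constructor
    · rintro ⟨s, hs, rfl⟩
      exact ⟨⟨s, hs⟩, rfl⟩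
    · rintro ⟨⟨s, hs⟩, rfl⟩
      exact ⟨s, hs, rfl⟩
  have hsub : LinearIndependent ℂ
      fun s : {s : Finset (Fin (2 * n)) // s.card = κ} => (majoranaProd s.1 : Op n) :=
    hli.comp _ Subtype.val_injective
  rw [majoranaModule, hset, finrank_span_eq_card hsub, Fintype.card_finset_len, Fintype.card_fin]

end Components

/-! ### The circuit and the design property -/

section Circuit

variable {L : ℕ}

theorem exists_exp_generator_eq (H : Generator n) : ∃ (a : ℕ) (ha : a + 1 < 2 * n), ∀ t : ℝ,
    NormedSpace.exp ((-(Complex.I * (t : ℂ))) • H.toOp) =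
      (Real.cos (-t) : ℂ) • (1 : Op n) + (Real.sin (-t) : ℂ) • rotor a ha := by
  obtain ⟨a, ha, h⟩ := exists_I_smul_toOp_eq_rotor H
  refine ⟨a, ha, fun t => ?_⟩
  rw [← exp_real_smul_of_mul_self_eq_neg_one (rotor_mul_self a ha), ← h]
  congr 1
  rw [← Complex.coe_smul, smul_smul]
  congr 1
  push_cast
  ring

theorem exp_generator_mem_unitaryGroup (H : Generator n) (t : ℝ) :
    NormedSpace.exp ((-(Complex.I * (t : ℂ))) • H.toOp) ∈ Matrix.unitaryGroup (Bits n) ℂ := by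
  obtain ⟨a, ha, h⟩ := exists_exp_generator_eq H
  obtain ⟨g, hg⟩ := exists_groupOp_eq_rotation a ha (-t)
  rw [h, ← hg]
  exact groupOp_mem_unitaryGroup g

theorem continuous_exp_generator (H : Generator n) :
    Continuous fun t : ℝ => NormedSpace.exp ((-(Complex.I * (t : ℂ))) • H.toOp) := by
  obtain ⟨a, ha, h⟩ := exists_exp_generator_eq H
  simp only [h]
  fun_prop

theorem circuit_mem_unitaryGroup (H : Fin L → Generator n) (θ : Fin L → ℝ) :
    circuit H θ ∈ Matrix.unitaryGroup (Bits n) ℂ := by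
  refine Submonoid.list_prod_mem _ fun U hU => ?_
  obtain ⟨l, rfl⟩ := (List.mem_ofFn' _ _).1 hU
  exact exp_generator_mem_unitaryGroup _ _

theorem continuous_circuit (H : Fin L → Generator n) : Continuous (circuit H) := by
  have h : ∀ θ, circuit H θ = ((List.finRange L).map fun l =>
      NormedSpace.exp ((-(Complex.I * (θ l : ℂ))) • (H l).toOp)).prod := by
    intro θ
    rw [circuit, List.ofFn_eq_map]
  simp only [funext h]
  exact continuous_list_prod _ fun l _ => (continuous_exp_generator (H l)).comp (continuous_apply l)

theorem trace_conj_mul_im_eq_zero {ρ O : Op n} (hρ : ρ.IsHermitian) (hO : O.IsHermitian)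
    (U : Op n) : (U * ρ * Uᴴ * O).trace.im = 0 := by
  rw [← Complex.conj_eq_iff_im, ← Complex.star_def, ← Matrix.trace_conjTranspose]
  simp only [Matrix.conjTranspose_mul, Matrix.conjTranspose_conjTranspose, hρ.eq, hO.eq]
  rw [Matrix.trace_mul_comm, ← mul_assoc]

theorem tensorPow_mul {ι : Type} [Fintype ι] (t : ℕ) (A B : Matrix ι ι ℂ) :
    tensorPow t A * tensorPow t B = tensorPow t (A * B) :=
  tensorProd_mul _ _

theorem trace_tensorPow {ι : Type} [Fintype ι] (t : ℕ) (A : Matrix ι ι ℂ) :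
    (tensorPow t A).trace = A.trace ^ t := by
  rw [tensorPow, tensorProd_trace]
  simp

theorem continuous_tensorPow (t : ℕ) : Continuous fun A : Op n => tensorPow t A :=
  continuous_matrix fun a b => by
    simp only [tensorPow, tensorProd, Matrix.of_apply]
    fun_prop

/-- A power of a trace is the trace of a tensor power, hence linear in the matrix entries that the
design condition controls. -/
theorem trace_conj_mul_pow_eq_sum (t : ℕ) (U ρ O : Op n) :
    (U * ρ * Uᴴ * O).trace ^ t = ∑ a, ∑ b,
      (tensorPow t U * tensorPow t ρ * tensorPow t Uᴴ) a b * tensorPow t O b a := by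
  rw [← trace_tensorPow, ← tensorPow_mul, ← tensorPow_mul, ← tensorPow_mul]
  simp only [Matrix.trace, Matrix.diag_apply, Matrix.mul_apply (N := tensorPow t O)]

theorem integral_trace_conj_mul_pow {Θ : Type*} [MeasurableSpace Θ] [TopologicalSpace Θ]
    [OpensMeasurableSpace Θ] {μ : Measure Θ} [IsFiniteMeasure μ] {U : Θ → Op n}
    (hU : Continuous U) (hU' : ∀ θ, U θ ∈ Matrix.unitaryGroup (Bits n) ℂ) (t : ℕ) (ρ O : Op n) :
    ∫ θ, (U θ * ρ * (U θ)ᴴ * O).trace ^ t ∂μ = ∑ a, ∑ b,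
      (∫ θ, (tensorPow t (U θ) * tensorPow t ρ * tensorPow t (U θ)ᴴ) a b ∂μ) *
        tensorPow t O b a := by
  have hint : ∀ a b, Integrable
      (fun θ => (tensorPow t (U θ) * tensorPow t ρ * tensorPow t (U θ)ᴴ) a b) μ := by
    intro a b
    refine integrable_comp_of_mem_unitaryGroup hU hU'
      (F := fun V => (tensorPow t V * tensorPow t ρ * tensorPow t Vᴴ) a b) ?_
    have h1 := continuous_tensorPow (n := n) t
    have h2 : Continuous fun V : Op n => tensorPow t Vᴴ := h1.comp (by fun_prop)
    exact ((h1.mul continuous_const).mul h2).matrix_elem a b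
  simp only [trace_conj_mul_pow_eq_sum]
  rw [integral_finsetSum _ fun a _ => integrable_finsetSum _ fun b _ => (hint a b).mul_const _]
  refine Finset.sum_congr rfl fun a _ => ?_
  rw [integral_finsetSum _ fun b _ => (hint a b).mul_const _]
  exact Finset.sum_congr rfl fun b _ => integral_mul_const _ _

theorem IsDesign.integral_loss_pow {H : Fin L → Generator n} {T : ℕ} {μ : Measure (Fin L → ℝ)}
    [IsFiniteMeasure μ] {ν : Measure (group n)} [IsFiniteMeasure ν]
    (h : IsDesign T μ (circuit H) ν) {t : ℕ} (ht : t ≤ T) (ρ O : Op n) :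
    ∫ θ, loss H ρ O θ ^ t ∂μ = ∫ g, (groupOp g * ρ * (groupOp g)ᴴ * O).trace ^ t ∂ν := by
  rw [integral_trace_conj_mul_pow continuous_groupOp groupOp_mem_unitaryGroup]
  refine (integral_trace_conj_mul_pow (continuous_circuit H) (circuit_mem_unitaryGroup H)
    t ρ O).trans ?_
  refine Finset.sum_congr rfl fun a _ => Finset.sum_congr rfl fun b _ => ?_
  rw [h t ht (tensorPow t ρ) a b]

theorem continuous_trace_conj_mul (ρ O : Op n) :
    Continuous fun U : Op n => (U * ρ * Uᴴ * O).trace :=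
  (((continuous_id.mul continuous_const).mul continuous_id.matrix_conjTranspose).mul
    continuous_const).matrix_trace

theorem memLp_loss_re (H : Fin L → Generator n) (ρ O : Op n) (μ : Measure (Fin L → ℝ))
    [IsFiniteMeasure μ] : MemLp (fun θ => (loss H ρ O θ).re) 2 μ := by
  obtain ⟨C, hC⟩ := exists_bound_of_mem_unitaryGroup (continuous_trace_conj_mul ρ O)
  refine MemLp.of_bound (Complex.continuous_re.comp
    ((continuous_trace_conj_mul ρ O).comp (continuous_circuit H))).aestronglyMeasurable C
    (Filter.Eventually.of_forall fun θ => ?_)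
  exact (Complex.abs_re_le_norm _).trans (hC _ (circuit_mem_unitaryGroup H θ))

end Circuit

/-! ### Mean and variance -/

theorem sum_range_split {f : ℕ → ℂ} (hn : 1 ≤ n) :
    ∑ κ ∈ Finset.range (2 * n + 1), f κ =
      f 0 + f (2 * n) + ∑ κ ∈ Finset.Icc 1 (2 * n - 1), f κ := by
  have h : Finset.range (2 * n) = insert 0 (Finset.Icc 1 (2 * n - 1)) := by
    ext κ
    simp only [Finset.mem_range, Finset.mem_insert, Finset.mem_Icc]
    omega
  rw [Finset.sum_range_succ, h, Finset.sum_insert (by simp)]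
  ring

end Matchgate

end

theorem theorem1 (n : ℕ) (hn : 1 ≤ n)
    -- the parametrized matchgate circuit, and the law of its parameters
    (L : ℕ) (H : Fin L → Matchgate.Generator n)
    (μ : Measure (Fin L → ℝ)) [IsProbabilityMeasure μ]
    -- the normalized Haar measure on `G = e^𝔤`
    (ν : Measure (Matchgate.group n)) [ν.IsHaarMeasure] [IsProbabilityMeasure ν]
    (hdesign : Matchgate.IsDesign 2 μ (Matchgate.circuit H) ν)
    (ρ O : Matchgate.Op n) (hρ : Matchgate.IsState ρ) (hO : O.IsHermitian) :
    -- the loss is a real, square-integrable random variable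
    (∀ θ, (Matchgate.loss H ρ O θ).im = 0) ∧
    MemLp (fun θ => (Matchgate.loss H ρ O θ).re) 2 μ ∧
    -- its mean
    ∫ θ, Matchgate.loss H ρ O θ ∂μ =
      ∑ κ ∈ ({0, 2 * n} : Finset ℕ),
        Matchgate.form (1 + Matchgate.parity n)
          (Matchgate.component κ ρ) (Matchgate.component κ O) ∧
    -- its variance
    ((Var[fun θ => (Matchgate.loss H ρ O θ).re; μ] : ℝ) : ℂ) =
      ∑ κ ∈ Finset.Icc 1 (2 * n - 1),
        (Matchgate.purity κ ρ * Matchgate.purity κ O +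
          Matchgate.coherence κ ρ * Matchgate.coherence κ O) /
          (Module.finrank ℂ (Matchgate.majoranaModule n κ) : ℂ) ∧
    -- the dimensions of the modules
    (∀ κ ≤ 2 * n, Module.finrank ℂ (Matchgate.majoranaModule n κ) = (2 * n).choose κ) := by
  have hρH : ρ.IsHermitian := hρ.posSemidef.isHermitian
  have him : ∀ θ, (Matchgate.loss H ρ O θ).im = 0 :=
    fun θ => Matchgate.trace_conj_mul_im_eq_zero hρH hO _
  have hre : ∀ θ, (((Matchgate.loss H ρ O θ).re : ℝ) : ℂ) = Matchgate.loss H ρ O θ :=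
    fun θ => Complex.ext rfl (him θ).symm
  have hmem := Matchgate.memLp_loss_re H ρ O μ
  have hmean : ∫ θ, Matchgate.loss H ρ O θ ∂μ =
      Matchgate.coord ∅ ρ * Matchgate.coord ∅ O +
        Matchgate.coord Finset.univ ρ * Matchgate.coord Finset.univ O := by
    have h := hdesign.integral_loss_pow one_le_two ρ O
    simp only [pow_one] at h
    rw [h, Matchgate.integral_trace_conj_mul hn]
  refine ⟨him, hmem, ?_, ?_, fun κ _ => Matchgate.finrank_majoranaModule n κ⟩
  · have hne : (0 : ℕ) ≠ 2 * n := by omega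
    rw [hmean, Finset.sum_congr rfl fun κ hκ =>
      Matchgate.form_one_add_parity_component hn hκ hρH O, Finset.sum_pair hne,
      Matchgate.powersetCard_univ_full, Finset.powersetCard_zero, Finset.sum_singleton,
      Finset.sum_singleton]
  · have hsq := hdesign.integral_loss_pow le_rfl ρ O
    rw [Matchgate.integral_trace_conj_mul_sq hn, Matchgate.sum_range_split hn] at hsq
    rw [variance_eq_sub hmem, Complex.ofReal_sub, Complex.ofReal_pow]
    simp only [Pi.pow_apply]
    rw [← integral_complex_ofReal, ← integral_complex_ofReal]
    simp only [Complex.ofReal_pow, hre]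
    -- It remains to see that the endpoint terms of the second moment equal the squared mean.
    rw [hsq, hmean, add_sub_right_comm, add_eq_right.2]
    · refine Finset.sum_congr rfl fun κ _ => ?_
      rw [Matchgate.finrank_majoranaModule, Matchgate.purity_eq_coordSq κ hρH,
        Matchgate.purity_eq_coordSq κ hO, Matchgate.coherence_mul_coherence κ hρH hO]
    · have h0 := Matchgate.parityPhase_mul_self (∅ : Finset (Fin (2 * n)))
      have h1 := Matchgate.parityPhase_mul_self (Finset.univ : Finset (Fin (2 * n)))
      simp only [Matchgate.coordSq, Matchgate.coordCross, Matchgate.powersetCard_univ_full,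
        Finset.powersetCard_zero, Finset.sum_singleton, Finset.compl_empty, Finset.compl_univ,
        Nat.choose_zero_right, Nat.choose_self, Nat.cast_one, div_one, pow_zero, one_mul]
      simp only [Finset.card_empty, Finset.card_univ, Fintype.card_fin, pow_mul, neg_one_sq,
        one_pow, pow_zero, one_mul] at h0 h1 ⊢
      linear_combination (Matchgate.coord ∅ ρ * Matchgate.coord Finset.univ ρ *
        (Matchgate.coord ∅ O * Matchgate.coord Finset.univ O)) * (h0 + h1)
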